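/- Fix integers $d$ and $r\ge 2$, and let $\Sigma=\{\rho_1,\ldots,\rho_r\}$ be density matrices on $\mathbb{C}^d$ (positive semidefinite $d\times d$ matrices of trace one) such that $\operatorname{supp}(\rho_i)\cap\operatorname{supp}(\rho_j)=\{0\}$ for all $i\neq j$ (Condition (LI)), where $\operatorname{supp}(\rho)$ is the subspace spanned by the columns of $\rho$. A quantum detector for $\Sigma^{\otimes n}=\{\rho_1^{\otimes n},\ldots,\rho_r^{\otimes n}\}$ is a tuple $E=(E_1,\ldots,E_r)$ of positive semidefinite $d^n\times d^n$ matrices with $\sum_{i=1}^r E_i=\mathbf{1}$, and its averaged error probability is $$\mathrm{Err}_n(E)=\frac1r\sum_{i=1}^r\operatorname{tr}\bigl[\rho_i^{\otimes n}(\mathbf 1-E_i)\bigr].$$ Put $$\xi_{\mathrm{QCB}}(\rho_i,\rho_j)=-\log\inf_{0\le s\le 1}\operatorname{tr}\bigl[\rho_i^{1-s}\rho_j^{s}\bigr],\qquad \xi_{\mathrm{QCB}}(\Sigma)=\min_{1\le i<j\le r}\xi_{\mathrm{QCB}}(\rho_i,\rho_j)\in[0,+\infty],$$ where $\log 0=-\infty$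 and $\rho^0=\mathbf 1$. Then there is a sequence of quantum detectors $E_{(n)}$ for $\Sigma^{\otimes n}$, $n\in\mathbb{N}$, such that $$\lim_{n\to\infty}-\frac1n\log \mathrm{Err}_n\bigl(E_{(n)}\bigr)=\xi_{\mathrm{QCB}}(\Sigma),$$ and, moreover, each $E_{(n)}$ can be taken to be a detector produced by the following Gram--Schmidt / maximum-likelihood algorithm applied to the states $\sigma_i=\rho_i^{\otimes n}$ on $\mathbb{C}^D$, $D=d^n$. Choose spectral decompositions $\sigma_i=\sum_{j=1}^{D}\lambda_{ij}|v_{ij}\rangle\langle v_{ij}|$ with orthonormal eigenbases $(v_{ij})_{j=1}^{D}$ (zero eigenvalues included), and let $\Lambda_0=(\lambda_{ij})_{i\le r,\,j\le D}$. For $s=1,\ldots,D$: (i) find a maximal entry, at position $(i^*,j^*)$ say, of $\Lambda_{s-1}$; choose a unit vector $e_s\in\operatorname{span}(e_1,\ldots,e_{s-1},v_{i^*j^*})$ with $e_s\perp\operatorname{span}(e_1,\ldots,e_{s-1})$, and set $\varphi(s)=i^*$; (ii) let $\Lambda_s$ be the matrix obtained from $\Lambda_{s-1}$ by replacing with $-1$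 all entries $\lambda_{ij}$ for which $v_{ij}\in\operatorname{span}(e_1,\ldots,e_s)$. The detector is $E_i=\sum_{s:\,\varphi(s)=i}|e_s\rangle\langle e_s|$, $i=1,\ldots,r$. -/

import Mathlib

open Filter Topology
open scoped ComplexOrder

noncomputable section

namespace MultipleQCB

variable {ι : Type*} [Fintype ι] [DecidableEq ι] {r : ℕ}

/-- A density matrix: positive semidefinite (hence self-adjoint) with unit trace. -/
def IsDensityMatrix (ρ : Matrix ι ι ℂ) : Prop :=
  ρ.PosSemidef ∧ ρ.trace = 1

/-- A quantum detector (POVM) with outcomes `Fin r`. -/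
def IsDetector (E : Fin r → Matrix ι ι ℂ) : Prop :=
  (∀ i, (E i).PosSemidef) ∧ ∑ i, E i = 1

/-- The support of a matrix: the subspace spanned by its columns. -/
def supp (ρ : Matrix ι ι ℂ) : Submodule ℂ (ι → ℂ) :=
  Submodule.span ℂ (Set.range fun j : ι => fun i : ι => ρ i j)

/-- The supports of any two different members of the family intersect trivially. -/
def ConditionLI (ρ : Fin r → Matrix ι ι ℂ) : Prop :=
  ∀ i j, i ≠ j → supp (ρ i) ⊓ supp (ρ j) = ⊥

/-- The `n`-fold tensor power of a matrix. The standard basis of the `n`-fold tensor power of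
`ℂ ^ ι` is indexed by the functions `Fin n → ι`. -/
def tensorPow (ρ : Matrix ι ι ℂ) (n : ℕ) : Matrix (Fin n → ι) (Fin n → ι) ℂ :=
  Matrix.of fun x y => ∏ k, ρ (x k) (y k)

/-- The averaged error probability `(1 / r) ∑ i, tr [ρ i (1 - E i)]`. -/
def err (ρ E : Fin r → Matrix ι ι ℂ) : ℝ :=
  (1 / (r : ℝ)) * ∑ i, ((ρ i * (1 - E i)).trace).re

/-- The logarithm with values in the extended reals, so that `log 0 = -∞`. -/
def elog (x : ℝ) : EReal :=
  ENNReal.log (ENNReal.ofReal x)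

/-- The power `ρ ^ s` of a positive semidefinite matrix, by the functional calculus. -/
def mpow (ρ : Matrix ι ι ℂ) (s : ℝ) : Matrix ι ι ℂ :=
  cfc (fun x : ℝ => x ^ s) ρ

/-- The binary quantum Chernoff bound `-log inf_{0 ≤ s ≤ 1} tr [ρ ^ (1 - s) σ ^ s]`. -/
def qcbPair (ρ σ : Matrix ι ι ℂ) : EReal :=
  -elog (⨅ s : Set.Icc (0 : ℝ) 1, ((mpow ρ (1 - s) * mpow σ s).trace).re)

/-- The multiple quantum Chernoff bound: the minimum of the binary ones over all pairs `i < j`. -/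
def qcb (ρ : Fin r → Matrix ι ι ℂ) : EReal :=
  ⨅ p : {p : Fin r × Fin r // p.1 < p.2}, qcbPair (ρ p.1.1) (ρ p.1.2)

/-- The rank one operator `|v⟩⟨v|`. -/
def ketBra (v : EuclideanSpace ℂ ι) : Matrix ι ι ℂ :=
  Matrix.of fun x y => v x * star (v y)

open Classical in
/-- The table of eigenvalues before step `s` of the algorithm: the entries `ev i j` whose
eigenvector lies in the span of the vectors `e t` of the earlier steps `t < s` are replaced
by `-1`. -/
def table (ev : Fin r → ι → ℝ) (v : Fin r → OrthonormalBasis ι ℂ (EuclideanSpace ℂ ι))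
    (e : Fin (Fintype.card ι) → EuclideanSpace ℂ ι) (s : Fin (Fintype.card ι))
    (i : Fin r) (j : ι) : ℝ :=
  if v i j ∈ Submodule.span ℂ (e '' Set.Iio s) then -1 else ev i j

/-- A run of the Gram-Schmidt maximum likelihood algorithm on the states `ρ`: spectral
decompositions (eigenvalues `ev i j`, eigenvectors `v i j`) are fixed; step `s` selects a maximal
entry `sel s` of the current table, and `e s` is a unit vector obtained by orthogonalizing the
selected eigenvector with respect to the vectors of the earlier steps. -/
structure IsRun (ρ : Fin r → Matrix ι ι ℂ) (ev : Fin r → ι → ℝ)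
    (v : Fin r → OrthonormalBasis ι ℂ (EuclideanSpace ℂ ι))
    (sel : Fin (Fintype.card ι) → Fin r × ι)
    (e : Fin (Fintype.card ι) → EuclideanSpace ℂ ι) : Prop where
  spectral : ∀ i, ρ i = ∑ j, (ev i j : ℂ) • ketBra (v i j)
  maximal : ∀ s i j, table ev v e s i j ≤ table ev v e s (sel s).1 (sel s).2
  norm_eq_one : ∀ s, ‖e s‖ = 1
  mem_span : ∀ s, e s ∈
    Submodule.span ℂ (insert (v (sel s).1 (sel s).2) (e '' Set.Iio s))
  orthogonal : ∀ s t, t < s → inner ℂ (e t) (e s) = 0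

/-- `E` is the projection valued measure produced by some run of the algorithm on `ρ`: the
outcome decided upon at the basis vector `e s` is the first component of `sel s`. -/
def IsAlgorithmDetector (ρ E : Fin r → Matrix ι ι ℂ) : Prop :=
  ∃ (ev : Fin r → ι → ℝ) (v : Fin r → OrthonormalBasis ι ℂ (EuclideanSpace ℂ ι))
    (sel : Fin (Fintype.card ι) → Fin r × ι)
    (e : Fin (Fintype.card ι) → EuclideanSpace ℂ ι),
    IsRun ρ ev v sel e ∧
    ∀ i, E i = ∑ s with (sel s).1 = i, ketBra (e s)

end MultipleQCB

end

/-! For two states with eigenpairs (λ_j, v_j) and (μ_l, w_l), the Nussbaum-Szkola measures P(j,l) =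
λ_j |⟨w_l, v_j⟩|² and Q(j,l) = μ_l |⟨w_l, v_j⟩|² satisfy ∑ P^(1-s) Q^s = tr[ρ^(1-s) σ^s] for 0 < s <
1, and they become product measures under tensor powers. Both bounds on the error compare it with
the classical overlap ∑ min(P, Q), called `minOverlap` for n copies, whose exponential rate is the
Chernoff quantity.

Upper bound. When the algorithm misattributes part of an eigenvector w of state i, that part lies in
the span of eigenvectors selected before w is absorbed. Greedy selection makes all of their
eigenvalues at least that of w, and those belonging to state i are orthogonal to w. If the
eigenvectors with nonzero eigenvalue have Gram matrix at least K > 0, Cauchy-Schwarz bounds the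
error by K⁻¹ times the sum of pairwise overlaps (`IsRun.error_le`, `IsRun.err_le`). The overlaps are
bounded by min(p, q) ≤ p^(1-s) q^s. Condition (LI) supplies K: two supports meeting trivially have a
cosine c < 1 between them, tensoring turns it into c^n, and so the Gram matrix is at least 1 - r
c^n, eventually above 1/2 (`gram_tensor_le`).

Lower bound. The error is at least a constant times the overlap of any one pair (`IsRun.le_err`),
and the classical Chernoff lower bound applies to it (`chernoff_lower`); it comes from exponential
tilting and the weak law of large numbers. The constants vanish under the n-th root. -/

namespace MultipleQCB

/-! ### Rank one operators -/

section KetBra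

variable {ι : Type*}

theorem ketBra_eq_vecMulVec (v : EuclideanSpace ℂ ι) :
    ketBra v = Matrix.vecMulVec v.ofLp (star v.ofLp) := by
  ext x y
  simp [ketBra, Matrix.vecMulVec_apply]

variable [Fintype ι]

theorem posSemidef_ketBra (v : EuclideanSpace ℂ ι) : (ketBra v).PosSemidef := by
  rw [ketBra_eq_vecMulVec]
  exact Matrix.posSemidef_vecMulVec_self_star _

theorem trace_ketBra_mul_ketBra (v w : EuclideanSpace ℂ ι) :
    (ketBra v * ketBra w).trace = ((‖inner ℂ w v‖ ^ 2 : ℝ) : ℂ) := by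
  have h : (inner ℂ v w : ℂ) * inner ℂ w v = ((‖inner ℂ w v‖ ^ 2 : ℝ) : ℂ) := by
    rw [← inner_conj_symm v w, RCLike.conj_mul]
    push_cast
    rfl
  rw [← h, ketBra_eq_vecMulVec, ketBra_eq_vecMulVec, Matrix.vecMulVec_mul_vecMulVec,
    Matrix.trace_vecMulVec, EuclideanSpace.inner_eq_star_dotProduct,
    EuclideanSpace.inner_eq_star_dotProduct, dotProduct_smul, dotProduct_comm w.ofLp]
  rfl

theorem ketBra_mulVec (v w : EuclideanSpace ℂ ι) :
    (ketBra v).mulVec w.ofLp = (inner ℂ v w • v).ofLp := by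
  rw [ketBra_eq_vecMulVec, Matrix.vecMulVec_mulVec, EuclideanSpace.inner_eq_star_dotProduct,
    dotProduct_comm]
  ext x
  simp [mul_comm]

theorem sum_ketBra_eq_one [DecidableEq ι] {κ : Type*} [Fintype κ]
    (b : OrthonormalBasis κ ℂ (EuclideanSpace ℂ ι)) : ∑ s, ketBra (b s) = 1 := by
  apply Matrix.toLin'.injective
  refine LinearMap.ext fun w => ?_
  rw [Matrix.toLin'_apply, Matrix.toLin'_apply, Matrix.one_mulVec, Matrix.sum_mulVec]
  have := b.sum_repr' (WithLp.toLp 2 w)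
  calc ∑ s, (ketBra (b s)).mulVec w
      = ∑ s, (inner ℂ (b s) (WithLp.toLp 2 w) • b s).ofLp :=
        Finset.sum_congr rfl fun s _ => ketBra_mulVec (b s) (WithLp.toLp 2 w)
    _ = w := by
        rw [← WithLp.ofLp_sum, this]

end KetBra

theorem norm_sq_sum_smul_of_orthonormal {E κ : Type*} [NormedAddCommGroup E]
    [InnerProductSpace ℂ E] {e : κ → E} (he : Orthonormal ℂ e) (S : Finset κ) (c : κ → ℂ) :
    ‖∑ s ∈ S, c s • e s‖ ^ 2 = ∑ s ∈ S, ‖c s‖ ^ 2 := by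
  rw [norm_sq_eq_re_inner (𝕜 := ℂ), he.inner_sum, map_sum]
  refine Finset.sum_congr rfl fun s _ => ?_
  rw [Complex.conj_mul', ← Complex.ofReal_pow]
  exact Complex.ofReal_re _

/-! ### Error bounds for one run of the algorithm -/

section Run

variable {ι : Type*} [Fintype ι] {r : ℕ}
  {ρ : Fin r → Matrix ι ι ℂ} {ev : Fin r → ι → ℝ}
  {v : Fin r → OrthonormalBasis ι ℂ (EuclideanSpace ℂ ι)}
  {sel : Fin (Fintype.card ι) → Fin r × ι} {e : Fin (Fintype.card ι) → EuclideanSpace ℂ ι}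

theorem IsRun.orthonormal (h : IsRun ρ ev v sel e) : Orthonormal ℂ e := by
  refine ⟨h.norm_eq_one, fun s t hst => ?_⟩
  rcases lt_or_gt_of_ne hst with hlt | hlt
  · exact h.orthogonal t s hlt
  · rw [← inner_conj_symm, h.orthogonal s t hlt, map_zero]

theorem IsRun.exists_basis [DecidableEq ι] (h : IsRun ρ ev v sel e) :
    ∃ b : OrthonormalBasis (Fin (Fintype.card ι)) ℂ (EuclideanSpace ℂ ι), ∀ s, b s = e s := by
  obtain ⟨b, hb⟩ := Orthonormal.exists_orthonormalBasis_extension_of_card_eq (𝕜 := ℂ)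
    (E := EuclideanSpace ℂ ι) (ι := Fin (Fintype.card ι)) (by simp) (v := e) (s := Set.univ)
    (h.orthonormal.comp _ Subtype.val_injective)
  exact ⟨b, fun s => hb s trivial⟩

theorem IsRun.inner_eq_zero_of_mem_span [DecidableEq ι] (h : IsRun ρ ev v sel e) {s : Fin (Fintype.card ι)}
    {x : EuclideanSpace ℂ ι} (hx : x ∈ Submodule.span ℂ (e '' Set.Iio s)) :
    inner ℂ (e s) x = 0 := by
  induction hx using Submodule.span_induction with
  | mem x hx =>
    obtain ⟨t, ht, rfl⟩ := hx
    exact h.orthonormal.2 (ne_of_gt ht)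
  | zero => simp
  | add x y _ _ hx hy => rw [inner_add_right, hx, hy, add_zero]
  | smul a x _ hx => rw [inner_smul_right, hx, mul_zero]

theorem IsRun.notMem_span [DecidableEq ι] (h : IsRun ρ ev v sel e) (s : Fin (Fintype.card ι)) :
    e s ∉ Submodule.span ℂ (e '' Set.Iio s) := fun hmem => by
  have h0 := h.inner_eq_zero_of_mem_span hmem
  have h1 := h.norm_eq_one s
  rw [inner_self_eq_zero.mp h0, norm_zero] at h1
  exact zero_ne_one h1

/-- Steinitz exchange: `e s` uses the selected vector nontrivially, so that vector is recovered from
`e s` and the earlier vectors. -/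
theorem IsRun.selected_mem_span [DecidableEq ι] (h : IsRun ρ ev v sel e) {s t : Fin (Fintype.card ι)}
    (hst : s < t) : v (sel s).1 (sel s).2 ∈ Submodule.span ℂ (e '' Set.Iio t) := by
  have h1 := mem_span_insert_exchange (h.mem_span s) (h.notMem_span s)
  refine Submodule.span_mono ?_ h1
  refine Set.insert_subset ⟨s, hst, rfl⟩ (Set.image_mono fun u hu => ?_)
  exact lt_trans hu hst

/-- A finite initial segment of the orthonormal vectors lies in the span of the
corresponding selected eigenvectors. -/
theorem IsRun.mem_span_selected (h : IsRun ρ ev v sel e) (T : Set (Fin (Fintype.card ι)))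
    (hT : ∀ s t, t < s → s ∈ T → t ∈ T) (s : Fin (Fintype.card ι)) (hs : s ∈ T) :
    e s ∈ Submodule.span ℂ ((fun p : Fin r × ι => v p.1 p.2) '' (sel '' T)) := by
  induction s using WellFoundedLT.induction with
  | ind s ih =>
    refine Submodule.span_le.mpr (Set.insert_subset ?_ ?_) (h.mem_span s)
    · exact Submodule.subset_span ⟨sel s, ⟨s, hs, rfl⟩, rfl⟩
    · rintro _ ⟨t, ht, rfl⟩
      exact ih t ht (hT s t ht hs)

/-- The greedy property. Positivity of `ev i j` excludes that the selected maximal entry is one of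
the replaced entries `-1`. -/
theorem IsRun.le_selected (h : IsRun ρ ev v sel e) {i : Fin r} {j : ι} (hpos : 0 < ev i j)
    {s : Fin (Fintype.card ι)} (hs : v i j ∉ Submodule.span ℂ (e '' Set.Iio s)) :
    ev i j ≤ ev (sel s).1 (sel s).2 := by
  have h1 := h.maximal s i j
  unfold table at h1
  rw [if_neg hs] at h1
  split_ifs at h1
  · linarith
  · exact h1

/-- The heart of the upper bound, for a single eigenvector `w`. Its wrongly attributed part is
contained in its projection `x` onto the span of the steps preceding its absorption. Expanding `x`
in the selected eigenvectors gives ‖x‖² = ⟨x, w⟩, where only eigenvectors of other states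
contribute, while `hgram` controls the coefficients by ‖x‖² / K. -/
theorem IsRun.error_le [DecidableEq ι] (h : IsRun ρ ev v sel e) {K : ℝ} (hK : 0 < K)
    (hev : ∀ i j, 0 ≤ ev i j)
    (hgram : ∀ c : Fin r × ι → ℂ, (∀ p, ev p.1 p.2 = 0 → c p = 0) →
      K * ∑ p, ‖c p‖ ^ 2 ≤ ‖∑ p, c p • v p.1 p.2‖ ^ 2) (i : Fin r) (j : ι) :
    ev i j * ∑ s with (sel s).1 ≠ i, ‖inner ℂ (e s) (v i j)‖ ^ 2 ≤
      K⁻¹ * ∑ k with k ≠ i, ∑ l, min (ev i j) (ev k l) * ‖inner ℂ (v k l) (v i j)‖ ^ 2 := by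
  classical
  have hrhs : 0 ≤ K⁻¹ * ∑ k with k ≠ i, ∑ l,
      min (ev i j) (ev k l) * ‖inner ℂ (v k l) (v i j)‖ ^ 2 :=
    mul_nonneg (inv_nonneg.mpr hK.le) <| Finset.sum_nonneg fun k _ => Finset.sum_nonneg fun l _ =>
      mul_nonneg (le_min (hev _ _) (hev _ _)) (sq_nonneg _)
  rcases (hev i j).eq_or_lt with h0 | hpos
  · rw [← h0, zero_mul]
    rwa [← h0] at hrhs
  set w := v i j with hw
  -- The steps at which `w` is not yet absorbed, without the step selecting `w` itself. They form an
  -- initial segment, since selecting `w` puts it into every later span.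
  set T : Finset (Fin (Fintype.card ι)) :=
    Finset.univ.filter fun s => w ∉ Submodule.span ℂ (e '' Set.Iio s) ∧ sel s ≠ (i, j) with hTdef
  have hTmem : ∀ s, s ∈ T ↔ w ∉ Submodule.span ℂ (e '' Set.Iio s) ∧ sel s ≠ (i, j) := by
    simp [hTdef]
  have hT : ∀ s t, t < s → s ∈ (T : Set (Fin (Fintype.card ι))) →
      t ∈ (T : Set (Fin (Fintype.card ι))) := by
    intro s t hts hs
    rw [Finset.mem_coe, hTmem] at hs ⊢
    refine ⟨fun hmem => hs.1 (Submodule.span_mono (Set.image_mono ?_) hmem), fun heq => hs.1 ?_⟩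
    · exact Set.Iio_subset_Iio hts.le
    · have := h.selected_mem_span hts
      rwa [heq] at this
  set X : ℝ := ∑ s ∈ T, ‖inner ℂ (e s) w‖ ^ 2 with hX
  -- Once `w` is in the span of the earlier vectors, `e s` is orthogonal to it, so wrong steps
  -- outside `T` contribute nothing.
  have hle : ∑ s with (sel s).1 ≠ i, ‖inner ℂ (e s) w‖ ^ 2 ≤ X := by
    rw [hX, ← Finset.sum_filter_add_sum_filter_not (Finset.univ.filter fun s => (sel s).1 ≠ i)
      (fun s => w ∈ Submodule.span ℂ (e '' Set.Iio s))]
    rw [Finset.sum_eq_zero, zero_add]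
    · refine Finset.sum_le_sum_of_subset_of_nonneg (fun s hs => ?_) fun _ _ _ => sq_nonneg _
      simp only [Finset.mem_filter, Finset.mem_univ, true_and] at hs
      rw [hTmem]
      refine ⟨hs.2, fun heq => hs.1 ?_⟩
      rw [heq]
    · intro s hs
      rw [h.inner_eq_zero_of_mem_span (Finset.mem_filter.mp hs).2]
      simp
  set x : EuclideanSpace ℂ ι := ∑ s ∈ T, inner ℂ (e s) w • e s with hx
  have hxw : inner ℂ x w = (X : ℂ) := by
    rw [hx, sum_inner, hX]
    push_cast
    refine Finset.sum_congr rfl fun s _ => ?_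
    rw [inner_smul_left, RCLike.conj_mul]
    rfl
  have hxx : ‖x‖ ^ 2 = X := norm_sq_sum_smul_of_orthonormal h.orthonormal _ _
  have hxmem : x ∈ Submodule.span ℂ ((fun p : Fin r × ι => v p.1 p.2) '' ↑(T.image sel)) := by
    rw [Finset.coe_image]
    exact Submodule.sum_mem _ fun s hs =>
      Submodule.smul_mem _ _ (h.mem_span_selected _ hT s hs)
  set Q := T.image sel with hQ
  obtain ⟨c₀, hc₀⟩ := (Submodule.mem_span_image_finset_iff_exists_fun ℂ).mp hxmem
  set c : Fin r × ι → ℂ := fun p => if hp : p ∈ Q then c₀ ⟨p, hp⟩ else 0 with hc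
  have hQle : ∀ p ∈ Q, ev i j ≤ ev p.1 p.2 ∧ p ≠ (i, j) := by
    intro p hp
    obtain ⟨s, hs, rfl⟩ := Finset.mem_image.mp hp
    rw [hTmem] at hs
    exact ⟨h.le_selected hpos hs.1, hs.2⟩
  have hcQ : ∀ p, p ∉ Q → c p = 0 := fun p hp => by simp [hc, hp]
  have hcx : ∑ p, c p • v p.1 p.2 = x := by
    rw [← hc₀, ← Finset.sum_subset (Finset.subset_univ Q) fun p _ hp => by rw [hcQ p hp, zero_smul],
      ← Finset.sum_coe_sort Q]
    exact Finset.sum_congr rfl fun p _ => by simp [hc]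
  -- The Gram bound applies because every selected eigenvalue is at least `ev i j > 0`.
  have hKc : K * ∑ p, ‖c p‖ ^ 2 ≤ X := by
    rw [← hxx, ← hcx]
    refine hgram c fun p hp => hcQ p fun hpQ => ?_
    have := (hQle p hpQ).1
    linarith
  -- Selected eigenvectors of state `i` differ from `w` and belong to the same orthonormal basis, so
  -- they drop out of ⟨x, w⟩.
  set Q' := Q.filter fun p => p.1 ≠ i with hQ'
  have hXle : X ≤ ∑ p ∈ Q', ‖c p‖ * ‖inner ℂ (v p.1 p.2) w‖ := by
    have h1 : (X : ℂ) = ∑ p ∈ Q', starRingEnd ℂ (c p) * inner ℂ (v p.1 p.2) w := by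
      rw [← hxw, ← hcx, sum_inner]
      simp_rw [inner_smul_left]
      refine (Finset.sum_subset (Finset.subset_univ Q') fun p _ hp => ?_).symm
      by_cases hpQ : p ∈ Q
      · have hpi : p.1 = i := by
          by_contra hne
          exact hp (Finset.mem_filter.mpr ⟨hpQ, hne⟩)
        have hpj : p.2 ≠ j := fun hj => (hQle p hpQ).2 (Prod.ext hpi hj)
        rw [hpi, hw, (v i).orthonormal.2 hpj, mul_zero]
      · rw [hcQ p hpQ, map_zero, zero_mul]
    have hX0 : 0 ≤ X := Finset.sum_nonneg fun _ _ => sq_nonneg _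
    calc X = ‖(X : ℂ)‖ := by rw [Complex.norm_real, Real.norm_of_nonneg hX0]
      _ ≤ ∑ p ∈ Q', ‖starRingEnd ℂ (c p) * inner ℂ (v p.1 p.2) w‖ := by
          rw [h1]; exact norm_sum_le _ _
      _ = _ := by simp
  set W : ℝ := ∑ p ∈ Q', ‖inner ℂ (v p.1 p.2) w‖ ^ 2 with hW
  have hX0 : 0 ≤ X := Finset.sum_nonneg fun _ _ => sq_nonneg _
  have hW0 : 0 ≤ W := Finset.sum_nonneg fun _ _ => sq_nonneg _
  have hXX : X ^ 2 ≤ (K⁻¹ * X) * W := by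
    calc X ^ 2 ≤ (∑ p ∈ Q', ‖c p‖ * ‖inner ℂ (v p.1 p.2) w‖) ^ 2 := by gcongr
      _ ≤ (∑ p ∈ Q', ‖c p‖ ^ 2) * W := Finset.sum_mul_sq_le_sq_mul_sq _ _ _
      _ ≤ (∑ p, ‖c p‖ ^ 2) * W := by
          gcongr
          exact Finset.subset_univ _
      _ ≤ (K⁻¹ * X) * W := by
          gcongr
          rw [inv_mul_eq_div, le_div_iff₀ hK, mul_comm]
          exact hKc
  have hXW : X ≤ K⁻¹ * W := by
    rcases hX0.eq_or_lt with hz | hp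
    · rw [← hz]; positivity
    · have : X * X ≤ X * (K⁻¹ * W) := by nlinarith [hXX]
      exact le_of_mul_le_mul_left this hp
  have hfin : ev i j * W ≤ ∑ k with k ≠ i, ∑ l,
      min (ev i j) (ev k l) * ‖inner ℂ (v k l) w‖ ^ 2 := by
    rw [← Finset.sum_product', hW, Finset.mul_sum]
    calc ∑ p ∈ Q', ev i j * ‖inner ℂ (v p.1 p.2) w‖ ^ 2
        = ∑ p ∈ Q', min (ev i j) (ev p.1 p.2) * ‖inner ℂ (v p.1 p.2) w‖ ^ 2 :=
          Finset.sum_congr rfl fun p hp => by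
            rw [min_eq_left (hQle p (Finset.mem_filter.mp hp).1).1]
      _ ≤ _ := by
          refine Finset.sum_le_sum_of_subset_of_nonneg (fun p hp => ?_) fun p _ _ =>
            mul_nonneg (le_min (hev _ _) (hev _ _)) (sq_nonneg _)
          simpa using (Finset.mem_filter.mp hp).2
  calc ev i j * ∑ s with (sel s).1 ≠ i, ‖inner ℂ (e s) w‖ ^ 2
      ≤ ev i j * (K⁻¹ * W) := by gcongr; exact hle.trans hXW
    _ = K⁻¹ * (ev i j * W) := by ring
    _ ≤ _ := by gcongr

theorem IsRun.isDetector [DecidableEq ι] (h : IsRun ρ ev v sel e) :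
    IsDetector fun i => ∑ s with (sel s).1 = i, ketBra (e s) := by
  refine ⟨fun i => Matrix.posSemidef_sum _ fun s _ => posSemidef_ketBra _, ?_⟩
  obtain ⟨b, hb⟩ := h.exists_basis
  rw [Finset.sum_fiberwise, ← sum_ketBra_eq_one b]
  simp_rw [hb]

theorem IsRun.one_sub [DecidableEq ι] (h : IsRun ρ ev v sel e) (i : Fin r) :
    1 - ∑ s with (sel s).1 = i, ketBra (e s) = ∑ s with (sel s).1 ≠ i, ketBra (e s) := by
  obtain ⟨b, hb⟩ := h.exists_basis
  rw [← sum_ketBra_eq_one b, sub_eq_iff_eq_add']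
  simp_rw [hb]
  exact (Finset.sum_filter_add_sum_filter_not _ _ _).symm

theorem IsRun.trace_error [DecidableEq ι] (h : IsRun ρ ev v sel e) (i : Fin r) :
    ((ρ i * (1 - ∑ s with (sel s).1 = i, ketBra (e s))).trace).re =
      ∑ j, ev i j * ∑ s with (sel s).1 ≠ i, ‖inner ℂ (e s) (v i j)‖ ^ 2 := by
  rw [h.one_sub, h.spectral i, Finset.sum_mul, Matrix.trace_sum, Complex.re_sum]
  refine Finset.sum_congr rfl fun j _ => ?_
  rw [Finset.mul_sum, Matrix.trace_sum, Complex.re_sum, Finset.mul_sum]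
  refine Finset.sum_congr rfl fun s _ => ?_
  rw [Matrix.smul_mul, Matrix.trace_smul, trace_ketBra_mul_ketBra, smul_eq_mul,
    ← Complex.ofReal_mul, Complex.ofReal_re]

/-- The error of the algorithm when the Gram matrix of the eigenvectors with nonzero eigenvalues is
bounded below by `K`. -/
theorem IsRun.err_le [DecidableEq ι] (h : IsRun ρ ev v sel e) {K : ℝ} (hK : 0 < K)
    (hev : ∀ i j, 0 ≤ ev i j)
    (hgram : ∀ c : Fin r × ι → ℂ, (∀ p, ev p.1 p.2 = 0 → c p = 0) →
      K * ∑ p, ‖c p‖ ^ 2 ≤ ‖∑ p, c p • v p.1 p.2‖ ^ 2) :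
    err ρ (fun i => ∑ s with (sel s).1 = i, ketBra (e s)) ≤
      (1 / (r : ℝ)) * (K⁻¹ * ∑ i, ∑ k with k ≠ i, ∑ j, ∑ l,
        min (ev i j) (ev k l) * ‖inner ℂ (v k l) (v i j)‖ ^ 2) := by
  unfold err
  refine mul_le_mul_of_nonneg_left ?_ (by positivity)
  rw [Finset.mul_sum]
  refine Finset.sum_le_sum fun i _ => ?_
  rw [h.trace_error, Finset.sum_comm, Finset.mul_sum]
  exact Finset.sum_le_sum fun j _ => h.error_le hK hev hgram i j

/-- The lower bound on the error by the classical overlap of the Nussbaum-Szkola distributions. -/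
theorem IsRun.le_err [DecidableEq ι] (h : IsRun ρ ev v sel e) (hev : ∀ i j, 0 ≤ ev i j) {i k : Fin r}
    (hik : k ≠ i) :
    (1 / (r : ℝ)) * (2⁻¹ * ∑ j, ∑ l,
        min (ev i j) (ev k l) * ‖inner ℂ (v k l) (v i j)‖ ^ 2) ≤
      err ρ (fun i => ∑ s with (sel s).1 = i, ketBra (e s)) := by
  obtain ⟨b, hb⟩ := h.exists_basis
  unfold err
  gcongr
  -- Insert the resolution of the identity by the `e s`, split according to the binary test "`i` or
  -- not `i`", and use |a + b|² ≤ 2(|a|² + |b|²). This is the source of the factor `2⁻¹`.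
  have hinner : ∀ j l, ‖inner ℂ (v k l) (v i j)‖ ^ 2 ≤
      2 * (‖∑ s with (sel s).1 ≠ i, inner ℂ (v k l) (e s) * inner ℂ (e s) (v i j)‖ ^ 2 +
        ‖∑ s with (sel s).1 = i, inner ℂ (v k l) (e s) * inner ℂ (e s) (v i j)‖ ^ 2) := by
    intro j l
    rw [← b.sum_inner_mul_inner (v k l) (v i j)]
    simp_rw [hb]
    rw [← Finset.sum_filter_add_sum_filter_not Finset.univ (fun s => (sel s).1 = i)]
    refine (pow_le_pow_left₀ (norm_nonneg _) (norm_add_le _ _) 2).trans ?_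
    nlinarith [sq_nonneg (‖∑ s with (sel s).1 = i, inner ℂ (v k l) (e s) * inner ℂ (e s) (v i j)‖ -
      ‖∑ s with ¬ (sel s).1 = i, inner ℂ (v k l) (e s) * inner ℂ (e s) (v i j)‖)]
  have hparseval : ∀ (S : Finset (Fin (Fintype.card ι))) (m : Fin r) (y : EuclideanSpace ℂ ι),
      ∑ l, ‖∑ s ∈ S, inner ℂ (v m l) (e s) * inner ℂ (e s) y‖ ^ 2 =
        ∑ s ∈ S, ‖inner ℂ (e s) y‖ ^ 2 := by
    intro S m y
    rw [← norm_sq_sum_smul_of_orthonormal h.orthonormal, ← (v m).sum_sq_norm_inner_right]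
    refine Finset.sum_congr rfl fun l _ => ?_
    rw [inner_sum]
    congr 2
    refine Finset.sum_congr rfl fun s _ => ?_
    rw [inner_smul_right, mul_comm]
  have hparseval' : ∀ (S : Finset (Fin (Fintype.card ι))) (m : Fin r) (y : EuclideanSpace ℂ ι),
      ∑ l, ‖∑ s ∈ S, inner ℂ y (e s) * inner ℂ (e s) (v m l)‖ ^ 2 =
        ∑ s ∈ S, ‖inner ℂ (e s) y‖ ^ 2 := by
    intro S m y
    rw [← hparseval S m y]
    refine Finset.sum_congr rfl fun l _ => ?_
    congr 1
    rw [← RCLike.norm_conj, map_sum]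
    congr 1
    refine Finset.sum_congr rfl fun s _ => ?_
    rw [map_mul, inner_conj_symm, inner_conj_symm, mul_comm]
  set a : Fin r → ℝ := fun m =>
    ((ρ m * (1 - ∑ s with (sel s).1 = m, ketBra (e s))).trace).re with ha
  have ha0 : ∀ m, 0 ≤ a m := fun m => by
    rw [ha]
    simp only
    rw [h.trace_error]
    exact Finset.sum_nonneg fun j _ => mul_nonneg (hev _ _) (Finset.sum_nonneg fun _ _ => sq_nonneg _)
  have hai : a i = ∑ j, ∑ l, ev i j *
      ‖∑ s with (sel s).1 ≠ i, inner ℂ (v k l) (e s) * inner ℂ (e s) (v i j)‖ ^ 2 := by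
    rw [ha]
    simp only
    rw [h.trace_error]
    refine Finset.sum_congr rfl fun j _ => ?_
    rw [← Finset.mul_sum, hparseval]
  -- Deciding for `i` is only one of the ways to err on state `k`, hence an inequality here.
  have hak : ∑ j, ∑ l, ev k l *
      ‖∑ s with (sel s).1 = i, inner ℂ (v k l) (e s) * inner ℂ (e s) (v i j)‖ ^ 2 ≤ a k := by
    rw [ha]
    simp only
    rw [h.trace_error, Finset.sum_comm]
    refine Finset.sum_le_sum fun l _ => ?_
    rw [← Finset.mul_sum, hparseval']
    refine mul_le_mul_of_nonneg_left ?_ (hev _ _)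
    refine Finset.sum_le_sum_of_subset_of_nonneg (fun s hs => ?_) fun _ _ _ => sq_nonneg _
    simp only [Finset.mem_filter, Finset.mem_univ, true_and] at hs ⊢
    rw [hs]
    exact hik.symm
  have hsum : a i + a k ≤ ∑ m, a m := by
    rw [← Finset.sum_pair hik.symm]
    exact Finset.sum_le_sum_of_subset_of_nonneg (Finset.subset_univ _) fun m _ _ => ha0 m
  refine le_trans ?_ hsum
  have hmain : ∑ j, ∑ l, min (ev i j) (ev k l) * ‖inner ℂ (v k l) (v i j)‖ ^ 2 ≤
      2 * (∑ j, ∑ l, ev i j *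
        ‖∑ s with (sel s).1 ≠ i, inner ℂ (v k l) (e s) * inner ℂ (e s) (v i j)‖ ^ 2 +
      ∑ j, ∑ l, ev k l *
        ‖∑ s with (sel s).1 = i, inner ℂ (v k l) (e s) * inner ℂ (e s) (v i j)‖ ^ 2) := by
    simp_rw [← Finset.sum_add_distrib, Finset.mul_sum]
    refine Finset.sum_le_sum fun j _ => Finset.sum_le_sum fun l _ => ?_
    have hm0 : 0 ≤ min (ev i j) (ev k l) := le_min (hev _ _) (hev _ _)
    refine (mul_le_mul_of_nonneg_left (hinner j l) hm0).trans ?_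
    rw [mul_left_comm, mul_add]
    refine mul_le_mul_of_nonneg_left (add_le_add ?_ ?_) zero_le_two
    · exact mul_le_mul_of_nonneg_right (min_le_left _ _) (sq_nonneg _)
    · exact mul_le_mul_of_nonneg_right (min_le_right _ _) (sq_nonneg _)
  linarith

end Run

end MultipleQCB

namespace MultipleQCB

/-! ### The algorithm never gets stuck -/

section Existence

variable {ι : Type*} [Fintype ι] {r : ℕ}

theorem exists_unit_vector_insert {v : EuclideanSpace ℂ ι} {S : Set (EuclideanSpace ℂ ι)}
    (hv : v ∉ Submodule.span ℂ S) :
    ∃ u : EuclideanSpace ℂ ι, ‖u‖ = 1 ∧ u ∈ Submodule.span ℂ (insert v S) ∧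
      ∀ w ∈ S, inner ℂ w u = 0 := by
  set P := Submodule.span ℂ S
  set x := v - (P.starProjection v) with hx
  have hx0 : x ≠ 0 := fun h0 => hv <| by
    rw [sub_eq_zero.mp h0]
    exact P.starProjection_apply_mem v
  have hxn : ‖x‖ ≠ 0 := norm_ne_zero_iff.mpr hx0
  refine ⟨((‖x‖⁻¹ : ℝ) : ℂ) • x, ?_, ?_, ?_⟩
  · rw [norm_smul, Complex.norm_real, norm_inv, norm_norm, inv_mul_cancel₀ hxn]
  · refine Submodule.smul_mem _ _ (Submodule.sub_mem _ (Submodule.subset_span (by simp)) ?_)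
    exact Submodule.span_mono (Set.subset_insert _ _) (P.starProjection_apply_mem v)
  · intro w hw
    rw [inner_smul_right]
    have := P.sub_starProjection_mem_orthogonal v
    rw [Submodule.mem_orthogonal] at this
    rw [this w (Submodule.subset_span hw), mul_zero]

/-- The algorithm can always be carried out. -/
theorem exists_isRun [DecidableEq ι] (hr : 0 < r) {ρ : Fin r → Matrix ι ι ℂ} {ev : Fin r → ι → ℝ}
    {v : Fin r → OrthonormalBasis ι ℂ (EuclideanSpace ℂ ι)} (hev : ∀ i j, 0 ≤ ev i j)
    (hρ : ∀ i, ρ i = ∑ j, (ev i j : ℂ) • ketBra (v i j)) :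
    ∃ sel e, IsRun ρ ev v sel e := by
  classical
  rcases isEmpty_or_nonempty ι with hι | hι
  · have : IsEmpty (Fin (Fintype.card ι)) := by rw [Fintype.card_eq_zero]; infer_instance
    exact ⟨fun s => isEmptyElim s, fun s => isEmptyElim s, hρ, fun s => isEmptyElim s,
      fun s => isEmptyElim s, fun s => isEmptyElim s, fun s => isEmptyElim s⟩
  have : Nonempty (Fin r) := ⟨⟨0, hr⟩⟩
  suffices H : ∀ m ≤ Fintype.card ι, ∃ (sel : Fin (Fintype.card ι) → Fin r × ι)
      (e : Fin (Fintype.card ι) → EuclideanSpace ℂ ι), ∀ s : Fin (Fintype.card ι), (s : ℕ) < m →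
        (∀ i j, table ev v e s i j ≤ table ev v e s (sel s).1 (sel s).2) ∧ ‖e s‖ = 1 ∧
        e s ∈ Submodule.span ℂ (insert (v (sel s).1 (sel s).2) (e '' Set.Iio s)) ∧
        ∀ t, t < s → inner ℂ (e t) (e s) = 0 by
    obtain ⟨sel, e, h⟩ := H _ le_rfl
    exact ⟨sel, e, hρ, fun s => (h s s.2).1, fun s => (h s s.2).2.1, fun s => (h s s.2).2.2.1,
      fun s => (h s s.2).2.2.2⟩
  intro m
  induction m with
  | zero => exact fun _ => ⟨fun _ => Classical.arbitrary _, fun _ => 0, fun s hs => by simp at hs⟩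
  | succ m ih =>
    intro hm
    obtain ⟨sel, e, h⟩ := ih (by omega)
    let s₀ : Fin (Fintype.card ι) := ⟨m, hm⟩
    obtain ⟨p, hp⟩ := Finite.exists_max fun p : Fin r × ι => table ev v e s₀ p.1 p.2
    -- Fewer than D vectors cannot span the space, so some eigenvector of each state is still
    -- outside; its nonnegative entry beats `-1`, and hence the maximal entry is not a replaced one.
    have hcard : Module.finrank ℂ (Submodule.span ℂ (e '' Set.Iio s₀)) ≤ m := by
      have h1 := finrank_span_finset_le_card (R := ℂ) ((Finset.Iio s₀).image e)
      rw [Finset.coe_image, Finset.coe_Iio] at h1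
      refine h1.trans (Finset.card_image_le.trans ?_)
      simp [s₀]
    have hnot : v p.1 p.2 ∉ Submodule.span ℂ (e '' Set.Iio s₀) := by
      intro hmem
      have hall : ∀ j, v p.1 j ∈ Submodule.span ℂ (e '' Set.Iio s₀) := by
        intro j
        by_contra hj
        have h1 := hp (p.1, j)
        unfold table at h1
        rw [if_neg hj, if_pos hmem] at h1
        linarith [hev p.1 j]
      have htop : Submodule.span ℂ (e '' Set.Iio s₀) = ⊤ := by
        rw [eq_top_iff, ← (v p.1).toBasis.span_eq, Submodule.span_le]
        rintro _ ⟨j, rfl⟩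
        simpa using hall j
      rw [htop, finrank_top, finrank_euclideanSpace] at hcard
      omega
    obtain ⟨u, hu1, hu2, hu3⟩ := exists_unit_vector_insert hnot
    have himg : ∀ s ≤ s₀, Function.update e s₀ u '' Set.Iio s = e '' Set.Iio s := by
      intro s hs
      refine Set.image_congr fun t ht => ?_
      exact Function.update_of_ne (ne_of_lt (lt_of_lt_of_le ht hs)) _ _
    refine ⟨Function.update sel s₀ p, Function.update e s₀ u, fun s hs => ?_⟩
    have hss : s ≤ s₀ := Fin.le_def.mpr (by simp [s₀]; omega)
    have htab : ∀ i j, table ev v (Function.update e s₀ u) s i j = table ev v e s i j := by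
      intro i j
      unfold table
      rw [himg s hss]
    rw [himg s hss]
    simp_rw [htab]
    rcases eq_or_lt_of_le hss with rfl | hlt
    · rw [Function.update_self, Function.update_self]
      refine ⟨fun i j => hp (i, j), hu1, hu2, fun t ht => ?_⟩
      rw [Function.update_of_ne (ne_of_lt ht)]
      exact hu3 _ ⟨t, ht, rfl⟩
    · rw [Function.update_of_ne (ne_of_lt hlt), Function.update_of_ne (ne_of_lt hlt)]
      obtain ⟨h1, h2, h3, h4⟩ := h s (Fin.lt_def.mp hlt)
      refine ⟨h1, h2, h3, fun t ht => ?_⟩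
      rw [Function.update_of_ne (ne_of_lt (ht.trans hlt))]
      exact h4 t ht

end Existence

end MultipleQCB

namespace MultipleQCB

/-! ### Tensor powers and the Gram matrix under Condition (LI) -/

section Tensor

variable {ι : Type*} [Fintype ι] {r : ℕ}

/-- The product vectors `b (x 0) ⊗ b (x 1) ⊗ ⋯`. -/
noncomputable def tensorVec {n : ℕ} (b : ι → EuclideanSpace ℂ ι) (x : Fin n → ι) :
    EuclideanSpace ℂ (Fin n → ι) :=
  WithLp.toLp 2 fun y => ∏ k, b (x k) (y k)

theorem inner_tensorVec {n : ℕ} (b b' : ι → EuclideanSpace ℂ ι) (x y : Fin n → ι) :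
    inner ℂ (tensorVec b x) (tensorVec b' y) = ∏ k, inner ℂ (b (x k)) (b' (y k)) := by
  simp_rw [PiLp.inner_apply]
  rw [Finset.prod_univ_sum, Fintype.piFinset_univ]
  refine Finset.sum_congr rfl fun z _ => ?_
  simp [tensorVec, Finset.prod_mul_distrib]

theorem orthonormal_tensorVec [DecidableEq ι] {n : ℕ} {b : ι → EuclideanSpace ℂ ι} (hb : Orthonormal ℂ b) :
    Orthonormal ℂ (tensorVec b : (Fin n → ι) → _) := by
  rw [orthonormal_iff_ite] at hb ⊢
  intro x y
  rw [inner_tensorVec]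
  simp_rw [hb, Finset.prod_ite_zero]
  simp [funext_iff]

theorem exists_tensor_basis [DecidableEq ι] (n : ℕ) (b : OrthonormalBasis ι ℂ (EuclideanSpace ℂ ι)) :
    ∃ B : OrthonormalBasis (Fin n → ι) ℂ (EuclideanSpace ℂ (Fin n → ι)),
      ∀ x, B x = tensorVec b x := by
  obtain ⟨B, hB⟩ := Orthonormal.exists_orthonormalBasis_extension_of_card_eq (𝕜 := ℂ)
    (E := EuclideanSpace ℂ (Fin n → ι)) (ι := Fin n → ι) (by simp) (v := tensorVec b)
    (s := Set.univ) ((orthonormal_tensorVec b.orthonormal).comp _ Subtype.val_injective)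
  exact ⟨B, fun s => hB s trivial⟩

theorem tensorPow_eq_sum (n : ℕ) {ρ : Matrix ι ι ℂ} {ev : ι → ℝ} {b : ι → EuclideanSpace ℂ ι}
    (h : ρ = ∑ j, (ev j : ℂ) • ketBra (b j)) :
    tensorPow ρ n = ∑ x : Fin n → ι, ((∏ k, ev (x k) : ℝ) : ℂ) • ketBra (tensorVec b x) := by
  ext y z
  have hentry : ∀ p q, ρ p q = ∑ j, (ev j : ℂ) * (b j p * star (b j q)) := by
    intro p q
    rw [h, Matrix.sum_apply]
    simp [ketBra]
  simp only [tensorPow, Matrix.of_apply, hentry]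
  rw [Finset.prod_univ_sum, Fintype.piFinset_univ, Matrix.sum_apply]
  refine Finset.sum_congr rfl fun x _ => ?_
  simp [ketBra, tensorVec, Finset.prod_mul_distrib]

theorem sum_fin_succ {α β : Type*} [Fintype α] [AddCommMonoid β] {n : ℕ}
    (f : (Fin (n + 1) → α) → β) :
    ∑ x, f x = ∑ a, ∑ x : Fin n → α, f (Fin.cons a x) := by
  rw [← (Fin.consEquiv fun _ => α).sum_comp, Fintype.sum_prod_type]
  rfl

/-- The operator norm of a tensor power is at most the power of the operator norm. -/
theorem sum_norm_sq_tensor_le {κ : Type*} [Fintype κ] {M : κ → ι → ℂ} {C : ℝ}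
    (hM : ∀ β : ι → ℂ, ∑ a, ‖∑ b, M a b * β b‖ ^ 2 ≤ C * ∑ b, ‖β b‖ ^ 2) (hC : 0 ≤ C) (n : ℕ)
    (β : (Fin n → ι) → ℂ) :
    ∑ x : Fin n → κ, ‖∑ y, (∏ k, M (x k) (y k)) * β y‖ ^ 2 ≤ C ^ n * ∑ y, ‖β y‖ ^ 2 := by
  induction n with
  | zero => simp
  | succ n ih =>
    simp_rw [sum_fin_succ, Fin.prod_univ_succ, Fin.cons_zero, Fin.cons_succ]
    rw [Finset.sum_comm]
    calc ∑ x : Fin n → κ, ∑ a,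
          ‖∑ b, ∑ y : Fin n → ι, (M a b * ∏ k, M (x k) (y k)) * β (Fin.cons b y)‖ ^ 2
        ≤ ∑ x : Fin n → κ,
          C * ∑ b, ‖∑ y : Fin n → ι, (∏ k, M (x k) (y k)) * β (Fin.cons b y)‖ ^ 2 := by
          refine Finset.sum_le_sum fun x _ => ?_
          refine le_trans (le_of_eq ?_)
            (hM fun b => ∑ y : Fin n → ι, (∏ k, M (x k) (y k)) * β (Fin.cons b y))
          simp_rw [Finset.mul_sum, mul_assoc]
      _ = C * ∑ b, ∑ x : Fin n → κ,
          ‖∑ y : Fin n → ι, (∏ k, M (x k) (y k)) * β (Fin.cons b y)‖ ^ 2 := by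
          rw [← Finset.mul_sum, Finset.sum_comm]
      _ ≤ C * ∑ b, C ^ n * ∑ y : Fin n → ι, ‖β (Fin.cons b y)‖ ^ 2 := by
          gcongr with b
          exact ih fun y => β (Fin.cons b y)
      _ = _ := by rw [← Finset.mul_sum, pow_succ']; ring

/-- By compactness of the unit spheres the largest cosine is attained; the value 1 would be equality
in Cauchy-Schwarz and give a common nonzero vector. -/
theorem exists_norm_inner_le_of_inf_eq_bot {E : Type*} [NormedAddCommGroup E]
    [InnerProductSpace ℂ E] [FiniteDimensional ℂ E] {U W : Submodule ℂ E} (h : U ⊓ W = ⊥) :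
    ∃ c : ℝ, 0 ≤ c ∧ c < 1 ∧ ∀ x ∈ U, ∀ y ∈ W, ‖inner ℂ x y‖ ≤ c * (‖x‖ * ‖y‖) := by
  set S : Set (E × E) := (Metric.sphere 0 1 ∩ U) ×ˢ (Metric.sphere 0 1 ∩ W) with hS
  have : ProperSpace E := FiniteDimensional.proper_rclike ℂ E
  have hScomp : IsCompact S :=
    ((isCompact_sphere 0 1).inter_right U.closed_of_finiteDimensional).prod
      ((isCompact_sphere 0 1).inter_right W.closed_of_finiteDimensional)
  have key : ∃ c : ℝ, 0 ≤ c ∧ c < 1 ∧ ∀ p ∈ S, ‖inner ℂ p.1 p.2‖ ≤ c := by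
    rcases S.eq_empty_or_nonempty with he | hne
    · exact ⟨0, le_rfl, one_pos, fun p hp => by rw [he] at hp; exact hp.elim⟩
    · obtain ⟨p, hp, hmax⟩ := hScomp.exists_isMaxOn hne
        (f := fun p : E × E => ‖inner ℂ p.1 p.2‖) (by fun_prop)
      refine ⟨_, norm_nonneg _, ?_, hmax⟩
      obtain ⟨⟨h1, h1U⟩, h2, h2W⟩ := hp
      rw [mem_sphere_zero_iff_norm] at h1 h2
      have hle : ‖inner ℂ p.1 p.2‖ ≤ ‖p.1‖ * ‖p.2‖ := norm_inner_le_norm _ _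
      refine lt_of_le_of_ne (by simpa [h1, h2] using hle) fun heq => ?_
      have hp1 : p.1 ≠ 0 := fun h0 => by simp [h0] at h1
      have hp2 : p.2 ≠ 0 := fun h0 => by simp [h0] at h2
      have heq' : ‖inner ℂ p.1 p.2 / ((‖p.1‖ : ℂ) * ‖p.2‖)‖ = 1 := by simp [h1, h2, heq]
      obtain ⟨-, a, -, ha⟩ := (norm_inner_div_norm_mul_norm_eq_one_iff p.1 p.2).mp heq'
      apply hp2
      have : p.2 ∈ U ⊓ W := ⟨by rw [ha]; exact U.smul_mem _ h1U, h2W⟩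
      rwa [h, Submodule.mem_bot] at this
  obtain ⟨c, hc0, hc1, hc⟩ := key
  refine ⟨c, hc0, hc1, fun x hx y hy => ?_⟩
  rcases eq_or_ne x 0 with rfl | hx0
  · simp
  rcases eq_or_ne y 0 with rfl | hy0
  · simp
  have hxn := norm_pos_iff.mpr hx0
  have hyn := norm_pos_iff.mpr hy0
  have := hc (((‖x‖⁻¹ : ℝ) : ℂ) • x, ((‖y‖⁻¹ : ℝ) : ℂ) • y)
    ⟨⟨by simp [norm_smul, hxn.ne'], U.smul_mem _ hx⟩, by simp [norm_smul, hyn.ne'], W.smul_mem _ hy⟩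
  simp only [inner_smul_left, inner_smul_right, norm_mul, Complex.conj_ofReal, Complex.norm_real,
    norm_inv, norm_norm] at this
  rw [← mul_assoc, ← mul_inv, inv_mul_le_iff₀ (by positivity)] at this
  linarith

theorem mem_supp_of_spectral {ρ : Matrix ι ι ℂ} {ev : ι → ℝ}
    {b : OrthonormalBasis ι ℂ (EuclideanSpace ℂ ι)} (h : ρ = ∑ j, (ev j : ℂ) • ketBra (b j))
    {j : ι} (hj : ev j ≠ 0) : (b j).ofLp ∈ supp ρ := by
  have h1 : ρ.mulVec (b j).ofLp = (ev j : ℂ) • (b j).ofLp := by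
    rw [h, Matrix.sum_mulVec, Finset.sum_eq_single j]
    · rw [Matrix.smul_mulVec, ketBra_mulVec, b.inner_eq_one, one_smul]
    · intro k _ hk
      rw [Matrix.smul_mulVec, ketBra_mulVec, b.orthonormal.2 hk]
      simp
    · simp
  have h2 : ρ.mulVec (b j).ofLp ∈ supp ρ := by
    have : ρ.mulVec (b j).ofLp ∈ LinearMap.range ρ.mulVecLin := ⟨_, rfl⟩
    rw [Matrix.range_mulVecLin] at this
    exact this
  rw [h1] at h2
  have h3 : ((ev j : ℂ)) ≠ 0 := by exact_mod_cast hj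
  exact ((supp ρ).smul_mem_iff h3).mp h2

/-- The overlap matrix of the eigenvectors with nonzero eigenvalues. -/
noncomputable def overlap (ev ev' : ι → ℝ) (b b' : ι → EuclideanSpace ℂ ι) (a a' : ι) : ℂ :=
  if ev a = 0 ∨ ev' a' = 0 then 0 else inner ℂ (b a) (b' a')

/-- The cosine between the supports bounds the operator norm of the overlap matrix, a form that
tensorizes. -/
theorem exists_overlap_le [DecidableEq ι] {ρ ρ' : Matrix ι ι ℂ} {ev ev' : ι → ℝ}
    {b b' : OrthonormalBasis ι ℂ (EuclideanSpace ℂ ι)}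
    (h : ρ = ∑ j, (ev j : ℂ) • ketBra (b j)) (h' : ρ' = ∑ j, (ev' j : ℂ) • ketBra (b' j))
    (hd : supp ρ ⊓ supp ρ' = ⊥) :
    ∃ c : ℝ, 0 ≤ c ∧ c < 1 ∧ ∀ β : ι → ℂ,
      ∑ a, ‖∑ a', overlap ev ev' b b' a a' * β a'‖ ^ 2 ≤ c ^ 2 * ∑ a', ‖β a'‖ ^ 2 := by
  set L : EuclideanSpace ℂ ι →ₗ[ℂ] (ι → ℂ) := (WithLp.linearEquiv 2 ℂ (ι → ℂ)).toLinearMap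
  have hd' : (supp ρ).comap L ⊓ (supp ρ').comap L = ⊥ := by
    rw [← Submodule.comap_inf, hd]
    exact LinearEquiv.ker _
  obtain ⟨c, hc0, hc1, hc⟩ := exists_norm_inner_le_of_inf_eq_bot hd'
  refine ⟨c, hc0, hc1, fun β => ?_⟩
  set y : EuclideanSpace ℂ ι := ∑ a' with ev' a' ≠ 0, β a' • b' a' with hy
  -- The projection of `y` onto the span of the eigenvectors of `ρ` with nonzero eigenvalue, so that
  -- ‖x‖² = ⟨x, y⟩ ≤ c ‖x‖ ‖y‖.
  set x : EuclideanSpace ℂ ι := ∑ a with ev a ≠ 0, inner ℂ (b a) y • b a with hx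
  have hyW : y ∈ (supp ρ').comap L := Submodule.sum_mem _ fun a ha =>
    Submodule.smul_mem _ _ (mem_supp_of_spectral h' (Finset.mem_filter.mp ha).2)
  have hxU : x ∈ (supp ρ).comap L := Submodule.sum_mem _ fun a ha =>
    Submodule.smul_mem _ _ (mem_supp_of_spectral h (Finset.mem_filter.mp ha).2)
  have hxn : ‖x‖ ^ 2 = ∑ a with ev a ≠ 0, ‖inner ℂ (b a) y‖ ^ 2 :=
    norm_sq_sum_smul_of_orthonormal b.orthonormal _ _
  have hyn : ‖y‖ ^ 2 ≤ ∑ a', ‖β a'‖ ^ 2 := by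
    rw [hy, norm_sq_sum_smul_of_orthonormal b'.orthonormal]
    exact Finset.sum_le_sum_of_subset_of_nonneg (Finset.subset_univ _) fun _ _ _ => sq_nonneg _
  have hxy : inner ℂ x y = ((‖x‖ ^ 2 : ℝ) : ℂ) := by
    rw [hxn, hx, sum_inner]
    push_cast
    refine Finset.sum_congr rfl fun s _ => ?_
    rw [inner_smul_left, Complex.conj_mul']
  have hxle : ‖x‖ ≤ c * ‖y‖ := by
    have h1 := hc x hxU y hyW
    rw [hxy, Complex.norm_real, Real.norm_of_nonneg (sq_nonneg _)] at h1
    rcases (norm_nonneg x).eq_or_lt with h0 | h0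
    · rw [← h0]; positivity
    · refine le_of_mul_le_mul_left ?_ h0
      nlinarith
  have hlhs : ∑ a, ‖∑ a', overlap ev ev' b b' a a' * β a'‖ ^ 2 = ‖x‖ ^ 2 := by
    rw [hxn, Finset.sum_filter]
    refine Finset.sum_congr rfl fun a _ => ?_
    split_ifs with ha
    · rw [hy, inner_sum, Finset.sum_filter]
      congr 2
      refine Finset.sum_congr rfl fun a' _ => ?_
      by_cases ha' : ev' a' = 0
      · simp [overlap, ha']
      · simp [overlap, ha, ha', inner_smul_right, mul_comm]
    · rw [not_not] at ha
      simp [overlap, ha]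
  rw [hlhs]
  calc ‖x‖ ^ 2 ≤ (c * ‖y‖) ^ 2 := by gcongr
    _ = c ^ 2 * ‖y‖ ^ 2 := by ring
    _ ≤ _ := by gcongr

theorem exists_uniform_overlap_le [DecidableEq ι] {ρ : Fin r → Matrix ι ι ℂ} {ev : Fin r → ι → ℝ}
    {b : Fin r → OrthonormalBasis ι ℂ (EuclideanSpace ℂ ι)}
    (h : ∀ i, ρ i = ∑ j, (ev i j : ℂ) • ketBra (b i j)) (hLI : ConditionLI ρ) :
    ∃ c : ℝ, 0 ≤ c ∧ c < 1 ∧ ∀ i k, i ≠ k → ∀ β : ι → ℂ,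
      ∑ a, ‖∑ a', overlap (ev i) (ev k) (b i) (b k) a a' * β a'‖ ^ 2 ≤
        c ^ 2 * ∑ a', ‖β a'‖ ^ 2 := by
  choose! c hc0 hc1 hc using fun (p : Fin r × Fin r) (hp : p.1 ≠ p.2) =>
    exists_overlap_le (h p.1) (h p.2) (hLI p.1 p.2 hp)
  rcases isEmpty_or_nonempty {p : Fin r × Fin r // p.1 ≠ p.2} with he | hne
  · exact ⟨0, le_rfl, one_pos, fun i k hik => (he.false ⟨(i, k), hik⟩).elim⟩
  obtain ⟨p, hp⟩ := Finite.exists_max fun p : {p : Fin r × Fin r // p.1 ≠ p.2} => c p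
  refine ⟨c p, hc0 _ p.2, hc1 _ p.2, fun i k hik β => (hc (i, k) hik β).trans ?_⟩
  gcongr
  · exact hc0 (i, k) hik
  · exact hp ⟨(i, k), hik⟩

/-- On coefficients supported on nonzero eigenvalues the inner product is the sesquilinear form of
the n-th tensor power of the overlap matrix, whose norm is at most c^n. -/
theorem norm_inner_tensor_le [DecidableEq ι] {n : ℕ} {ev ev' : ι → ℝ}
    {b b' : OrthonormalBasis ι ℂ (EuclideanSpace ℂ ι)} {c : ℝ} (hc : 0 ≤ c)
    (hM : ∀ β : ι → ℂ, ∑ a, ‖∑ a', overlap ev ev' b b' a a' * β a'‖ ^ 2 ≤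
      c ^ 2 * ∑ a', ‖β a'‖ ^ 2) {α β : (Fin n → ι) → ℂ}
    (hα : ∀ x, ∏ k, ev (x k) = 0 → α x = 0) (hβ : ∀ x, ∏ k, ev' (x k) = 0 → β x = 0) :
    ‖inner ℂ (∑ x, α x • tensorVec b x) (∑ y, β y • tensorVec b' y)‖ ≤
      c ^ n * (‖∑ x, α x • tensorVec b x‖ * ‖∑ y, β y • tensorVec b' y‖) := by
  have h1 : inner ℂ (∑ x, α x • tensorVec b x) (∑ y, β y • tensorVec b' y) =
      ∑ x : Fin n → ι, starRingEnd ℂ (α x) *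
        ∑ y : Fin n → ι, (∏ k, overlap ev ev' b b' (x k) (y k)) * β y := by
    rw [sum_inner]
    refine Finset.sum_congr rfl fun x _ => ?_
    rw [inner_smul_left, inner_sum]
    by_cases hx : ∏ k, ev (x k) = 0
    · simp [hα x hx]
    congr 1
    refine Finset.sum_congr rfl fun y _ => ?_
    rw [inner_smul_right, inner_tensorVec, mul_comm]
    by_cases hy : ∏ k, ev' (y k) = 0
    · simp [hβ y hy]
    rw [Finset.prod_eq_zero_iff, not_exists] at hx hy
    congr 1
    refine Finset.prod_congr rfl fun k _ => ?_
    have := hx k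
    have := hy k
    simp_all [overlap]
  have hN : ∀ (b : OrthonormalBasis ι ℂ (EuclideanSpace ℂ ι)) (α : (Fin n → ι) → ℂ),
      ‖∑ x, α x • tensorVec b x‖ ^ 2 = ∑ x, ‖α x‖ ^ 2 := fun b α =>
    norm_sq_sum_smul_of_orthonormal (orthonormal_tensorVec b.orthonormal) _ _
  refine (sq_le_sq₀ (norm_nonneg _) (by positivity)).mp ?_
  rw [mul_pow, mul_pow, hN, hN, h1]
  calc _ ≤ (∑ x : Fin n → ι, ‖α x‖ *
        ‖∑ y : Fin n → ι, (∏ k, overlap ev ev' b b' (x k) (y k)) * β y‖) ^ 2 := by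
        gcongr
        refine (norm_sum_le _ _).trans (le_of_eq ?_)
        simp
    _ ≤ (∑ x, ‖α x‖ ^ 2) * ∑ x : Fin n → ι,
        ‖∑ y : Fin n → ι, (∏ k, overlap ev ev' b b' (x k) (y k)) * β y‖ ^ 2 :=
        Finset.sum_mul_sq_le_sq_mul_sq _ _ _
    _ ≤ (∑ x, ‖α x‖ ^ 2) * ((c ^ 2) ^ n * ∑ y, ‖β y‖ ^ 2) := by
        gcongr
        exact sum_norm_sq_tensor_le hM (sq_nonneg c) n β
    _ = _ := by rw [← pow_mul, ← pow_mul, mul_comm 2 n]; ring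

/-- Lower bound for the Gram matrix of the product eigenvectors with nonzero eigenvalues. -/
theorem gram_tensor_le [DecidableEq ι] {n : ℕ} {ev : Fin r → ι → ℝ}
    {b : Fin r → OrthonormalBasis ι ℂ (EuclideanSpace ℂ ι)} {c : ℝ} (hc : 0 ≤ c)
    (hM : ∀ i k, i ≠ k → ∀ β : ι → ℂ,
      ∑ a, ‖∑ a', overlap (ev i) (ev k) (b i) (b k) a a' * β a'‖ ^ 2 ≤
        c ^ 2 * ∑ a', ‖β a'‖ ^ 2)
    (γ : Fin r × (Fin n → ι) → ℂ) (hγ : ∀ p, ∏ k, ev p.1 (p.2 k) = 0 → γ p = 0) :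
    (1 - c ^ n * r) * ∑ p, ‖γ p‖ ^ 2 ≤ ‖∑ p, γ p • tensorVec (b p.1) p.2‖ ^ 2 := by
  set u : Fin r → EuclideanSpace ℂ (Fin n → ι) := fun i => ∑ x, γ (i, x) • tensorVec (b i) x with hu
  have hun : ∀ i, ‖u i‖ ^ 2 = ∑ x, ‖γ (i, x)‖ ^ 2 := fun i =>
    norm_sq_sum_smul_of_orthonormal (orthonormal_tensorVec (b i).orthonormal) _ _
  rw [Fintype.sum_prod_type, Fintype.sum_prod_type]
  simp_rw [← hun]
  change _ ≤ ‖∑ i, u i‖ ^ 2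
  -- On the diagonal the subtracted term is pure slack; allowing it makes the double sum factor into
  -- (∑ ‖u i‖)².
  have hterm : ∀ i k, (if i = k then ‖u i‖ ^ 2 else 0) - c ^ n * (‖u i‖ * ‖u k‖) ≤
      RCLike.re (inner ℂ (u i) (u k)) := by
    intro i k
    split_ifs with hik
    · rw [← hik, ← norm_sq_eq_re_inner]
      have : 0 ≤ c ^ n * (‖u i‖ * ‖u i‖) := by positivity
      linarith
    · have h1 := norm_inner_tensor_le (n := n) hc (hM i k hik) (α := fun x => γ (i, x))
        (β := fun x => γ (k, x)) (fun x hx => hγ (i, x) hx) (fun x hx => hγ (k, x) hx)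
      have h2 := (abs_le.mp (RCLike.abs_re_le_norm (inner ℂ (u i) (u k)))).1
      have h3 : ‖inner ℂ (u i) (u k)‖ ≤ c ^ n * (‖u i‖ * ‖u k‖) := h1
      linarith
  have hexp : ‖∑ i, u i‖ ^ 2 = ∑ i, ∑ k, RCLike.re (inner ℂ (u i) (u k)) := by
    rw [norm_sq_eq_re_inner (𝕜 := ℂ), sum_inner, map_sum]
    refine Finset.sum_congr rfl fun i _ => ?_
    rw [inner_sum, map_sum]
  have hcs : (∑ i, ‖u i‖) ^ 2 ≤ r * ∑ i, ‖u i‖ ^ 2 := by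
    simpa using sq_sum_le_card_mul_sum_sq (s := Finset.univ) (f := fun i => ‖u i‖)
  rw [hexp]
  calc (1 - c ^ n * r) * ∑ i, ‖u i‖ ^ 2
      = ∑ i, ‖u i‖ ^ 2 - c ^ n * (r * ∑ i, ‖u i‖ ^ 2) := by ring
    _ ≤ ∑ i, ‖u i‖ ^ 2 - c ^ n * (∑ i, ‖u i‖) ^ 2 := by gcongr
    _ = ∑ i, ∑ k, ((if i = k then ‖u i‖ ^ 2 else 0) - c ^ n * (‖u i‖ * ‖u k‖)) := by
        simp_rw [Finset.sum_sub_distrib, Finset.sum_ite_eq, Finset.mem_univ, if_true,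
          ← Finset.mul_sum]
        rw [sq, Finset.sum_mul_sum]
        simp_rw [Finset.mul_sum]
    _ ≤ _ := Finset.sum_le_sum fun i _ => Finset.sum_le_sum fun k _ => hterm i k

end Tensor

end MultipleQCB

namespace MultipleQCB

/-! ### The classical Chernoff lower bound -/

section Chernoff

variable {α : Type*} [Fintype α]

theorem sum_prod_eq_one {R : α → ℝ} (hR : ∑ a, R a = 1) (n : ℕ) :
    ∑ z : Fin n → α, ∏ k, R (z k) = 1 := by
  induction n with
  | zero => simp
  | succ n ih =>
    simp_rw [sum_fin_succ, Fin.prod_univ_succ, Fin.cons_zero, Fin.cons_succ, ← Finset.mul_sum, ih,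
      mul_one, hR]

theorem sum_prod_mul_sum_eq_zero {R g : α → ℝ} (hR : ∑ a, R a = 1) (hg : ∑ a, R a * g a = 0)
    (n : ℕ) : ∑ z : Fin n → α, (∏ k, R (z k)) * ∑ k, g (z k) = 0 := by
  induction n with
  | zero => simp
  | succ n ih =>
    simp_rw [sum_fin_succ, Fin.prod_univ_succ, Fin.sum_univ_succ, Fin.cons_zero, Fin.cons_succ]
    have : ∀ a, ∑ x : Fin n → α, R a * (∏ k, R (x k)) * (g a + ∑ k, g (x k)) = R a * g a := by
      intro a
      calc _ = R a * g a * ∑ x : Fin n → α, ∏ k, R (x k) +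
            R a * ∑ x : Fin n → α, (∏ k, R (x k)) * ∑ k, g (x k) := by
            rw [Finset.mul_sum, Finset.mul_sum, ← Finset.sum_add_distrib]
            exact Finset.sum_congr rfl fun x _ => by ring
        _ = _ := by rw [ih, sum_prod_eq_one hR]; ring
    simp_rw [this, hg]

/-- The variance of a sum of independent centered variables. -/
theorem sum_prod_mul_sum_sq {R g : α → ℝ} (hR : ∑ a, R a = 1) (hg : ∑ a, R a * g a = 0) (n : ℕ) :
    ∑ z : Fin n → α, (∏ k, R (z k)) * (∑ k, g (z k)) ^ 2 = n * ∑ a, R a * g a ^ 2 := by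
  induction n with
  | zero => simp
  | succ n ih =>
    simp_rw [sum_fin_succ, Fin.prod_univ_succ, Fin.sum_univ_succ, Fin.cons_zero, Fin.cons_succ]
    have : ∀ a, ∑ x : Fin n → α, R a * (∏ k, R (x k)) * (g a + ∑ k, g (x k)) ^ 2 =
        R a * g a ^ 2 + R a * (n * ∑ a, R a * g a ^ 2) := by
      intro a
      calc _ = R a * g a ^ 2 * ∑ x : Fin n → α, ∏ k, R (x k) +
            2 * R a * g a * ∑ x : Fin n → α, (∏ k, R (x k)) * ∑ k, g (x k) +
            R a * ∑ x : Fin n → α, (∏ k, R (x k)) * (∑ k, g (x k)) ^ 2 := by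
            rw [Finset.mul_sum, Finset.mul_sum, Finset.mul_sum, ← Finset.sum_add_distrib,
              ← Finset.sum_add_distrib]
            exact Finset.sum_congr rfl fun x _ => by ring
        _ = _ := by rw [ih, sum_prod_eq_one hR, sum_prod_mul_sum_eq_zero hR hg]; ring
    simp_rw [this, Finset.sum_add_distrib, ← Finset.sum_mul, hR]
    push_cast
    ring

/-- The weak law of large numbers on a finite probability space. -/
theorem eventually_half_le_sum_prod {R g : α → ℝ} (hR0 : ∀ a, 0 ≤ R a) (hR : ∑ a, R a = 1)
    (hg : ∑ a, R a * g a = 0) {ε : ℝ} (hε : 0 < ε) :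
    ∀ᶠ n : ℕ in atTop,
      1 / 2 ≤ ∑ z : Fin n → α with |∑ k, g (z k)| ≤ n * ε, ∏ k, R (z k) := by
  set V := ∑ a, R a * g a ^ 2 with hV
  filter_upwards [eventually_ge_atTop (⌈2 * V / ε ^ 2⌉₊), eventually_gt_atTop 0] with n hn hn0
  have hn' : 2 * V / ε ^ 2 ≤ n := Nat.ceil_le.mp hn
  have hnpos : (0 : ℝ) < n := by exact_mod_cast hn0
  have hsplit := Finset.sum_filter_add_sum_filter_not Finset.univ
    (fun z : Fin n → α => |∑ k, g (z k)| ≤ n * ε) (fun z => ∏ k, R (z k))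
  rw [sum_prod_eq_one hR] at hsplit
  have hprod : ∀ z : Fin n → α, 0 ≤ ∏ k, R (z k) := fun z => Finset.prod_nonneg fun _ _ => hR0 _
  -- Chebyshev's inequality.
  have hbad : (∑ z : Fin n → α with ¬ |∑ k, g (z k)| ≤ n * ε, ∏ k, R (z k)) * (n * ε) ^ 2 ≤
      n * V := by
    rw [← sum_prod_mul_sum_sq hR hg n, Finset.sum_mul]
    refine (Finset.sum_le_sum fun z hz => ?_).trans
      (Finset.sum_le_sum_of_subset_of_nonneg (Finset.subset_univ _) fun z _ _ =>
        mul_nonneg (hprod z) (sq_nonneg _))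
    refine mul_le_mul_of_nonneg_left ?_ (hprod z)
    have h1 := (Finset.mem_filter.mp hz).2
    rw [not_le] at h1
    rw [← sq_abs (∑ k, g (z k))]
    have : 0 ≤ n * ε := by positivity
    gcongr
  have hbad' : ∑ z : Fin n → α with ¬ |∑ k, g (z k)| ≤ n * ε, ∏ k, R (z k) ≤ 1 / 2 := by
    refine le_of_mul_le_mul_right (hbad.trans ?_) (show 0 < (n * ε) ^ 2 by positivity)
    rw [div_le_iff₀ (by positivity)] at hn'
    nlinarith
  linarith

theorem hasDerivAt_tilted (P l : α → ℝ) (s : ℝ) :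
    HasDerivAt (fun s => ∑ a, P a * Real.exp (s * l a)) (∑ a, P a * Real.exp (s * l a) * l a) s := by
  refine HasDerivAt.fun_sum fun a _ => ?_
  have h1 : HasDerivAt (fun s => s * l a) (1 * l a) s := (hasDerivAt_id s).mul_const _
  simpa only [one_mul, ← mul_assoc] using h1.exp.const_mul (P a)

theorem deriv_mul_nonneg_of_isMinOn {f : ℝ → ℝ} {f' s t : ℝ} (hf : HasDerivAt f f' s)
    (hs : s ∈ Set.Icc (0 : ℝ) 1) (ht : t ∈ Set.Icc (0 : ℝ) 1)
    (hmin : IsMinOn f (Set.Icc 0 1) s) : 0 ≤ (t - s) * f' := by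
  have h1 := IsLocalMinOn.hasFDerivWithinAt_nonneg (y := t - s) hmin.localize
    hf.hasFDerivAt.hasFDerivWithinAt
    (sub_mem_posTangentConeAt_of_segment_subset ((convex_Icc (0 : ℝ) 1).segment_subset hs ht))
  simpa using h1

/-- Tilt to R ∝ P^(1-s) Q^s at a minimizer `s` of the normalization `f`. The first-order condition
fixes the sign of the mean `m` of the log-likelihood ratio, and on sequences typical for R both
products are at least f(s)^n e^(-nε) R(z). -/
theorem chernoff_lower_of_pos {P Q : α → ℝ} (hP : ∀ a, 0 < P a) (hQ : ∀ a, 0 < Q a) {q : ℝ}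
    (hq : 0 < q) (hle : ∀ s ∈ Set.Ioo (0 : ℝ) 1, q ≤ ∑ a, P a ^ (1 - s) * Q a ^ s) {ε : ℝ}
    (hε : 0 < ε) :
    ∀ᶠ n : ℕ in atTop, 1 / 2 * (q * Real.exp (-ε)) ^ n ≤
      ∑ z : Fin n → α, min (∏ k, P (z k)) (∏ k, Q (z k)) := by
  set l : α → ℝ := fun a => Real.log (Q a) - Real.log (P a) with hl
  set f : ℝ → ℝ := fun s => ∑ a, P a * Real.exp (s * l a) with hf
  have hfc : Continuous f := by fun_prop
  have hfeq : ∀ s, f s = ∑ a, P a ^ (1 - s) * Q a ^ s := by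
    intro s
    refine Finset.sum_congr rfl fun a _ => ?_
    rw [Real.rpow_def_of_pos (hP a), Real.rpow_def_of_pos (hQ a)]
    nth_rewrite 1 [← Real.exp_log (hP a)]
    rw [← Real.exp_add, ← Real.exp_add]
    congr 1
    simp only [hl]
    ring
  obtain ⟨s, hs, hmin⟩ := isCompact_Icc.exists_isMinOn
    (Set.nonempty_Icc.mpr (zero_le_one (α := ℝ))) hfc.continuousOn
  have hqf : q ≤ f s := by
    have h1 : Set.Icc (0 : ℝ) 1 ⊆ {s | q ≤ f s} := by
      rw [← closure_Ioo (zero_ne_one (α := ℝ))]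
      refine closure_minimal (fun s hs => ?_) (isClosed_le continuous_const hfc)
      rw [Set.mem_ofPred_eq, hfeq]
      exact hle s hs
    exact h1 hs
  have hfpos : 0 < f s := hq.trans_le hqf
  set R : α → ℝ := fun a => P a * Real.exp (s * l a) / f s with hRdef
  have hR0 : ∀ a, 0 ≤ R a := fun a => by
    have := hP a
    positivity
  have hR1 : ∑ a, R a = 1 := by
    rw [hRdef, ← Finset.sum_div]
    exact div_self hfpos.ne'
  set m : ℝ := ∑ a, R a * l a with hm
  have hfm : (∑ a, P a * Real.exp (s * l a) * l a) = f s * m := by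
    rw [hm, Finset.mul_sum]
    refine Finset.sum_congr rfl fun a _ => ?_
    rw [hRdef]
    field_simp
  have hd := hasDerivAt_tilted P l s
  rw [hfm] at hd
  -- Testing minimality towards both endpoints covers boundary minimizers too; for an interior `s`
  -- the two inequalities give m = 0.
  have hm1 : 0 ≤ (1 - s) * m := by
    have := deriv_mul_nonneg_of_isMinOn hd hs ⟨zero_le_one, le_rfl⟩ hmin
    rw [mul_left_comm] at this
    exact nonneg_of_mul_nonneg_right this hfpos
  have hm0 : 0 ≤ -s * m := by
    have := deriv_mul_nonneg_of_isMinOn hd hs ⟨le_rfl, zero_le_one⟩ hmin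
    rw [mul_left_comm, zero_sub] at this
    exact nonneg_of_mul_nonneg_right this hfpos
  have hg0 : ∑ a, R a * (l a - m) = 0 := by
    simp_rw [mul_sub, Finset.sum_sub_distrib, ← Finset.sum_mul, hR1, ← hm]
    ring
  filter_upwards [eventually_half_le_sum_prod hR0 hR1 hg0 hε] with n hn
  have hPz : ∀ z : Fin n → α, ∏ k, P (z k) =
      f s ^ n * (∏ k, R (z k)) * Real.exp (-s * ∑ k, l (z k)) := by
    intro z
    rw [Finset.mul_sum, Real.exp_sum, mul_assoc, ← Finset.prod_mul_distrib]
    have hfn : f s ^ n = ∏ _k : Fin n, f s := by simp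
    rw [hfn, ← Finset.prod_mul_distrib]
    refine Finset.prod_congr rfl fun k _ => ?_
    rw [hRdef, neg_mul, Real.exp_neg]
    have := Real.exp_pos (s * l (z k))
    field_simp
  have hQz : ∀ z : Fin n → α, ∏ k, Q (z k) =
      f s ^ n * (∏ k, R (z k)) * Real.exp ((1 - s) * ∑ k, l (z k)) := by
    intro z
    have h1 : ∏ k, Q (z k) = (∏ k, P (z k)) * Real.exp (∑ k, l (z k)) := by
      rw [Real.exp_sum, ← Finset.prod_mul_distrib]
      refine Finset.prod_congr rfl fun k _ => ?_
      rw [hl, Real.exp_sub, Real.exp_log (hP _), Real.exp_log (hQ _),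
        mul_div_cancel₀ _ (hP _).ne']
    rw [h1, hPz, mul_assoc, ← Real.exp_add]
    congr 2
    ring
  have hprod : ∀ z : Fin n → α, 0 ≤ ∏ k, R (z k) := fun z => Finset.prod_nonneg fun _ _ => hR0 _
  have hgood : ∀ z : Fin n → α, |∑ k, (l (z k) - m)| ≤ n * ε →
      f s ^ n * Real.exp (-(n * ε)) * ∏ k, R (z k) ≤ min (∏ k, P (z k)) (∏ k, Q (z k)) := by
    intro z hz
    rw [Finset.sum_sub_distrib, Finset.sum_const, Finset.card_univ, Fintype.card_fin, nsmul_eq_mul,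
      abs_le] at hz
    set L := ∑ k, l (z k)
    have hn0 : (0 : ℝ) ≤ n := n.cast_nonneg
    have hnε : 0 ≤ n * ε := by positivity
    rw [hPz, hQz, mul_right_comm]
    have hc : 0 ≤ f s ^ n * ∏ k, R (z k) := mul_nonneg (by positivity) (hprod z)
    refine le_min (mul_le_mul_of_nonneg_left (Real.exp_le_exp.mpr ?_) hc)
      (mul_le_mul_of_nonneg_left (Real.exp_le_exp.mpr ?_) hc)
    · have h1 := mul_nonneg hs.1 (sub_nonneg.mpr hz.2)
      have h2 := mul_nonneg hn0 hm0
      have h3 := mul_nonneg (sub_nonneg.mpr hs.2) hnε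
      nlinarith
    · have h1 := mul_nonneg (sub_nonneg.mpr hs.2) (sub_nonneg.mpr hz.1)
      have h2 := mul_nonneg hn0 hm1
      have h3 := mul_nonneg hs.1 hnε
      nlinarith
  calc 1 / 2 * (q * Real.exp (-ε)) ^ n ≤ 1 / 2 * (f s * Real.exp (-ε)) ^ n := by gcongr
    _ = f s ^ n * Real.exp (-(n * ε)) * (1 / 2) := by
        rw [mul_pow, ← Real.exp_nat_mul, mul_neg]; ring
    _ ≤ f s ^ n * Real.exp (-(n * ε)) *
        ∑ z : Fin n → α with |∑ k, (l (z k) - m)| ≤ n * ε, ∏ k, R (z k) := by gcongr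
    _ ≤ ∑ z : Fin n → α with |∑ k, (l (z k) - m)| ≤ n * ε,
        min (∏ k, P (z k)) (∏ k, Q (z k)) := by
        rw [Finset.mul_sum]
        exact Finset.sum_le_sum fun z hz => hgood z (Finset.mem_filter.mp hz).2
    _ ≤ _ := Finset.sum_le_sum_of_subset_of_nonneg (Finset.subset_univ _) fun z _ _ =>
        le_min (Finset.prod_nonneg fun _ _ => (hP _).le) (Finset.prod_nonneg fun _ _ => (hQ _).le)

/-- The classical Chernoff lower bound for two measures on a finite set. -/
theorem chernoff_lower {P Q : α → ℝ} (hP : ∀ a, 0 ≤ P a) (hQ : ∀ a, 0 ≤ Q a) {q : ℝ}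
    (hq : 0 < q) (hle : ∀ s ∈ Set.Ioo (0 : ℝ) 1, q ≤ ∑ a, P a ^ (1 - s) * Q a ^ s) {ε : ℝ}
    (hε : 0 < ε) :
    ∀ᶠ n : ℕ in atTop, 1 / 2 * (q * Real.exp (-ε)) ^ n ≤
      ∑ z : Fin n → α, min (∏ k, P (z k)) (∏ k, Q (z k)) := by
  classical
  -- Restrict to the common support of P and Q. For s strictly between 0 and 1 the discarded terms
  -- vanish; at the endpoints `0 ^ 0 = 1` could keep them, which is why the hypothesis is over the
  -- open interval.
  have hpos := chernoff_lower_of_pos (α := {a // 0 < P a ∧ 0 < Q a}) (P := fun a => P a)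
    (Q := fun a => Q a) (fun a => a.2.1) (fun a => a.2.2) hq (fun s hs => ?_) hε
  · filter_upwards [hpos] with n hn
    refine hn.trans ?_
    let φ : (Fin n → {a // 0 < P a ∧ 0 < Q a}) ↪ (Fin n → α) :=
      ⟨fun z k => z k, fun z z' h => funext fun k => Subtype.ext (congrFun h k)⟩
    have := Finset.sum_map Finset.univ φ fun z => min (∏ k, P (z k)) (∏ k, Q (z k))
    refine (le_of_eq this.symm).trans
      (Finset.sum_le_sum_of_subset_of_nonneg (Finset.subset_univ _) fun z _ _ =>
        le_min (Finset.prod_nonneg fun _ _ => hP _) (Finset.prod_nonneg fun _ _ => hQ _))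
  · refine (hle s hs).trans (le_of_eq ?_)
    rw [← Finset.sum_subtype (Finset.univ.filter fun a => 0 < P a ∧ 0 < Q a) (by simp)
      (fun a => P a ^ (1 - s) * Q a ^ s)]
    refine (Finset.sum_subset (Finset.subset_univ _) fun a _ ha => ?_).symm
    simp only [Finset.mem_filter, Finset.mem_univ, true_and, not_and_or, not_lt] at ha
    rcases ha with ha | ha
    · rw [le_antisymm ha (hP a), Real.zero_rpow (sub_pos.mpr hs.2).ne', zero_mul]
    · rw [le_antisymm ha (hQ a), Real.zero_rpow hs.1.ne', mul_zero]

end Chernoff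

end MultipleQCB

namespace MultipleQCB

/-! ### Nussbaum-Szkola overlaps -/

section Spectral

variable {ι : Type*} [Fintype ι]

theorem exists_spectral [DecidableEq ι] {ρ : Matrix ι ι ℂ} (hρ : ρ.PosSemidef) :
    ∃ (ev : ι → ℝ) (b : OrthonormalBasis ι ℂ (EuclideanSpace ℂ ι)), (∀ j, 0 ≤ ev j) ∧
      ρ = ∑ j, (ev j : ℂ) • ketBra (b j) ∧
      ∀ s, mpow ρ s = ∑ j, ((ev j ^ s : ℝ) : ℂ) • ketBra (b j) := by
  have hH := hρ.isHermitian
  have hdiag : ∀ g : ι → ℝ, Unitary.conjStarAlgAut ℂ (Matrix ι ι ℂ) hH.eigenvectorUnitary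
      (Matrix.diagonal (RCLike.ofReal ∘ g)) =
      ∑ j, (g j : ℂ) • ketBra (hH.eigenvectorBasis j) := by
    intro g
    ext x y
    rw [Unitary.conjStarAlgAut_apply, Matrix.sum_apply, Matrix.mul_apply]
    refine Finset.sum_congr rfl fun j _ => ?_
    rw [Matrix.mul_diagonal]
    simp [ketBra, Matrix.star_apply]
    ring
  refine ⟨hH.eigenvalues, hH.eigenvectorBasis, hρ.eigenvalues_nonneg, ?_, fun s => ?_⟩
  · rw [← hdiag]
    exact hH.spectral_theorem
  · rw [mpow, hH.cfc_eq, ← hdiag fun j => hH.eigenvalues j ^ s]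
    rfl

theorem trace_sum_ketBra_mul (f g : ι → ℝ) (b b' : ι → EuclideanSpace ℂ ι) :
    (((∑ j, (f j : ℂ) • ketBra (b j)) * ∑ l, (g l : ℂ) • ketBra (b' l)).trace).re =
      ∑ j, ∑ l, f j * g l * ‖inner ℂ (b' l) (b j)‖ ^ 2 := by
  rw [Finset.sum_mul, Matrix.trace_sum, Complex.re_sum]
  refine Finset.sum_congr rfl fun j _ => ?_
  rw [Finset.mul_sum, Matrix.trace_sum, Complex.re_sum]
  refine Finset.sum_congr rfl fun l _ => ?_
  rw [Matrix.smul_mul, Matrix.mul_smul, Matrix.trace_smul, Matrix.trace_smul,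
    trace_ketBra_mul_ketBra, smul_eq_mul, smul_eq_mul, ← Complex.ofReal_mul, ← Complex.ofReal_mul,
    Complex.ofReal_re, mul_assoc]

/-- The overlap of the Nussbaum-Szkola distributions of two tensor powers. -/
noncomputable def minOverlap (n : ℕ) (ev ev' : ι → ℝ) (b b' : ι → EuclideanSpace ℂ ι) : ℝ :=
  ∑ x : Fin n → ι, ∑ y : Fin n → ι, min (∏ k, ev (x k)) (∏ k, ev' (y k)) *
    ‖inner ℂ (tensorVec b' y) (tensorVec b x)‖ ^ 2

theorem minOverlap_comm (n : ℕ) (ev ev' : ι → ℝ) (b b' : ι → EuclideanSpace ℂ ι) :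
    minOverlap n ev ev' b b' = minOverlap n ev' ev b' b := by
  unfold minOverlap
  rw [Finset.sum_comm]
  simp_rw [min_comm, norm_inner_symm]

theorem sum_arrow_prod {n : ℕ} (f : (Fin n → ι) → (Fin n → ι) → ℝ) :
    ∑ x, ∑ y, f x y = ∑ z : Fin n → ι × ι, f (fun k => (z k).1) fun k => (z k).2 := by
  rw [← Fintype.sum_prod_type', ← (Equiv.arrowProdEquivProdArrow (Fin n) (fun _ => ι)
    (fun _ => ι)).sum_comp]
  rfl

/-- Pointwise min(p, q) ≤ p^(1-s) q^s, after which the sum over product vectors factorizes into an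
n-th power. -/
theorem minOverlap_le [DecidableEq ι] {n : ℕ} {ev ev' : ι → ℝ} {b b' : ι → EuclideanSpace ℂ ι}
    (hev : ∀ j, 0 ≤ ev j) (hev' : ∀ j, 0 ≤ ev' j) {s : ℝ} (hs : s ∈ Set.Icc (0 : ℝ) 1) :
    minOverlap n ev ev' b b' ≤
      (∑ j, ∑ l, ev j ^ (1 - s) * ev' l ^ s * ‖inner ℂ (b' l) (b j)‖ ^ 2) ^ n := by
  have hmin : ∀ p q : ℝ, 0 ≤ p → 0 ≤ q → min p q ≤ p ^ (1 - s) * q ^ s := by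
    intro p q hp hq
    have hm : 0 ≤ min p q := le_min hp hq
    calc min p q = min p q ^ (1 - s) * min p q ^ s := by
          rw [← Real.rpow_add' hm (by simp), sub_add_cancel, Real.rpow_one]
      _ ≤ _ := mul_le_mul (Real.rpow_le_rpow hm (min_le_left _ _) (sub_nonneg.mpr hs.2))
          (Real.rpow_le_rpow hm (min_le_right _ _) hs.1) (Real.rpow_nonneg hm _)
          (Real.rpow_nonneg hp _)
  unfold minOverlap
  rw [sum_arrow_prod, ← Fintype.sum_prod_type', Finset.sum_pow', Fintype.piFinset_univ]
  refine Finset.sum_le_sum fun z _ => ?_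
  rw [inner_tensorVec, norm_prod, ← Finset.prod_pow, Finset.prod_mul_distrib,
    Finset.prod_mul_distrib, Real.finsetProd_rpow _ _ fun k _ => hev _,
    Real.finsetProd_rpow _ _ fun k _ => hev' _]
  refine mul_le_mul_of_nonneg_right (hmin _ _ ?_ ?_) (Finset.prod_nonneg fun _ _ => sq_nonneg _)
  · exact Finset.prod_nonneg fun _ _ => hev _
  · exact Finset.prod_nonneg fun _ _ => hev' _

/-- The overlap is the classical one of the Nussbaum-Szkola measures: the common factor |⟨b' l, b
j⟩|² comes out of the minimum, and its exponents 1 - s and s add up to 1. -/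
theorem eventually_le_minOverlap [DecidableEq ι] {ev ev' : ι → ℝ} {b b' : ι → EuclideanSpace ℂ ι}
    (hev : ∀ j, 0 ≤ ev j) (hev' : ∀ j, 0 ≤ ev' j) {q : ℝ} (hq : 0 < q)
    (hle : ∀ s ∈ Set.Ioo (0 : ℝ) 1,
      q ≤ ∑ j, ∑ l, ev j ^ (1 - s) * ev' l ^ s * ‖inner ℂ (b' l) (b j)‖ ^ 2)
    {ε : ℝ} (hε : 0 < ε) :
    ∀ᶠ n : ℕ in atTop, 1 / 2 * (q * Real.exp (-ε)) ^ n ≤ minOverlap n ev ev' b b' := by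
  have h := chernoff_lower (α := ι × ι) (P := fun p => ev p.1 * ‖inner ℂ (b' p.2) (b p.1)‖ ^ 2)
    (Q := fun p => ev' p.2 * ‖inner ℂ (b' p.2) (b p.1)‖ ^ 2)
    (fun p => mul_nonneg (hev _) (sq_nonneg _)) (fun p => mul_nonneg (hev' _) (sq_nonneg _)) hq
    (fun s hs => ?_) hε
  · filter_upwards [h] with n hn
    refine hn.trans (le_of_eq ?_)
    unfold minOverlap
    rw [sum_arrow_prod]
    refine Finset.sum_congr rfl fun z _ => ?_
    rw [inner_tensorVec, norm_prod, ← Finset.prod_pow, Finset.prod_mul_distrib,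
      Finset.prod_mul_distrib, min_mul_of_nonneg _ _ (Finset.prod_nonneg fun _ _ => sq_nonneg _)]
  · refine (hle s hs).trans (le_of_eq ?_)
    rw [← Fintype.sum_prod_type']
    refine Finset.sum_congr rfl fun p _ => ?_
    have ho : 0 ≤ ‖inner ℂ (b' p.2) (b p.1)‖ ^ 2 := sq_nonneg _
    rw [Real.mul_rpow (hev _) ho, Real.mul_rpow (hev' _) ho, mul_mul_mul_comm,
      ← Real.rpow_add' ho (by simp), sub_add_cancel, Real.rpow_one]

end Spectral

/-! ### From exponential bounds to the error exponent -/

section Limit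

theorem elog_mono {x y : ℝ} (h : x ≤ y) : elog x ≤ elog y :=
  ENNReal.log_monotone (ENNReal.ofReal_le_ofReal h)

theorem tendsto_const_rpow_one_div {c : ℝ} (hc : 0 < c) :
    Tendsto (fun n : ℕ => c ^ (1 / (n : ℝ))) atTop (𝓝 1) := by
  have h1 := (Real.continuous_const_rpow hc.ne').tendsto 0
  rw [Real.rpow_zero] at h1
  exact h1.comp tendsto_one_div_atTop_nhds_zero_nat

/-- The strict slack between `q'` and `q` absorbs the constants, whose n-th roots tend to 1. For q =
0 the lower requirement is vacuous, which covers an infinite exponent. -/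
theorem tendsto_rpow_one_div {e : ℕ → ℝ} (he : ∀ n, 0 ≤ e n) {q : ℝ} (hq : 0 ≤ q)
    (hup : ∀ q', q < q' → ∃ C > 0, ∀ᶠ n : ℕ in atTop, e n ≤ C * q' ^ n)
    (hlow : ∀ q', 0 < q' → q' < q → ∃ c > 0, ∀ᶠ n : ℕ in atTop, c * q' ^ n ≤ e n) :
    Tendsto (fun n : ℕ => e n ^ (1 / (n : ℝ))) atTop (𝓝 q) := by
  have hroot : ∀ {c q' : ℝ} {n : ℕ}, 0 < c → 0 ≤ q' → 0 < n →
      (c * q' ^ n) ^ (1 / (n : ℝ)) = c ^ (1 / (n : ℝ)) * q' := by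
    intro c q' n hc hq' hn
    rw [Real.mul_rpow hc.le (pow_nonneg hq' n), one_div, Real.pow_rpow_inv_natCast hq' hn.ne']
  refine tendsto_order.mpr ⟨fun a ha => ?_, fun a ha => ?_⟩
  · rcases lt_or_ge a 0 with ha0 | ha0
    · exact Eventually.of_forall fun n => ha0.trans_le (Real.rpow_nonneg (he n) _)
    · obtain ⟨q', haq', hq'⟩ := exists_between ha
      have hq'0 : 0 < q' := ha0.trans_lt haq'
      obtain ⟨c, hc, hcn⟩ := hlow q' hq'0 hq'
      have hlim := (tendsto_const_rpow_one_div hc).mul_const q'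
      rw [one_mul] at hlim
      filter_upwards [hcn, hlim.eventually_const_lt haq', eventually_gt_atTop 0] with n h1 h2 h3
      refine h2.trans_le ?_
      rw [← hroot hc hq'0.le h3]
      exact Real.rpow_le_rpow (by positivity) h1 (by positivity)
  · obtain ⟨q', hqq', hq'⟩ := exists_between ha
    have hq'0 : 0 < q' := hq.trans_lt hqq'
    obtain ⟨c, hc, hcn⟩ := hup q' hqq'
    have hlim := (tendsto_const_rpow_one_div hc).mul_const q'
    rw [one_mul] at hlim
    filter_upwards [hcn, hlim.eventually_lt_const hq', eventually_gt_atTop 0] with n h1 h2 h3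
    refine lt_of_le_of_lt ?_ h2
    rw [← hroot hc hq'0.le h3]
    exact Real.rpow_le_rpow (he n) h1 (by positivity)

theorem tendsto_neg_one_div_mul_elog {e : ℕ → ℝ} (he : ∀ n, 0 ≤ e n) {q : ℝ}
    (h : Tendsto (fun n : ℕ => e n ^ (1 / (n : ℝ))) atTop (𝓝 q)) :
    Tendsto (fun n : ℕ => ((-(1 / (n : ℝ)) : ℝ) : EReal) * elog (e n)) atTop (𝓝 (-elog q)) := by
  have h1 : Tendsto (fun n : ℕ => -elog (e n ^ (1 / (n : ℝ)))) atTop (𝓝 (-elog q)) :=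
    (continuous_neg.tendsto _).comp ((ENNReal.continuous_log.tendsto _).comp
      (ENNReal.tendsto_ofReal h))
  refine h1.congr fun n => ?_
  unfold elog
  rw [← ENNReal.ofReal_rpow_of_nonneg (he n) (by positivity), ENNReal.log_rpow, EReal.coe_neg,
    EReal.neg_mul]

end Limit

end MultipleQCB

/-! ### Assembly of the main theorem -/

namespace MultipleQCB

theorem IsRun.err_nonneg {ι : Type*} [Fintype ι] [DecidableEq ι] {r : ℕ}
    {ρ : Fin r → Matrix ι ι ℂ} {ev : Fin r → ι → ℝ}
    {v : Fin r → OrthonormalBasis ι ℂ (EuclideanSpace ℂ ι)}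
    {sel : Fin (Fintype.card ι) → Fin r × ι} {e : Fin (Fintype.card ι) → EuclideanSpace ℂ ι}
    (h : IsRun ρ ev v sel e) (hev : ∀ i j, 0 ≤ ev i j) :
    0 ≤ err ρ (fun i => ∑ s with (sel s).1 = i, ketBra (e s)) := by
  unfold err
  refine mul_nonneg (by positivity) (Finset.sum_nonneg fun i _ => ?_)
  rw [h.trace_error]
  exact Finset.sum_nonneg fun j _ => mul_nonneg (hev _ _) (Finset.sum_nonneg fun _ _ => sq_nonneg _)

/-- The Gram-Schmidt maximum likelihood detectors attain the multiple quantum Chernoff bound. -/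
theorem exists_algorithmDetector_tendsto_qcb (d r : ℕ) (hr : 2 ≤ r) (ρ : Fin r → Matrix (Fin d) (Fin d) ℂ)
    (hρ : ∀ i, IsDensityMatrix (ρ i)) (hLI : ConditionLI ρ) :
    ∃ E : (n : ℕ) → Fin r → Matrix (Fin n → Fin d) (Fin n → Fin d) ℂ,
      (∀ n, IsDetector (E n)) ∧
      (∀ n, IsAlgorithmDetector (fun i => tensorPow (ρ i) n) (E n)) ∧
      Tendsto
        (fun n : ℕ => ((-(1 / (n : ℝ)) : ℝ) : EReal) *
          elog (err (fun i => tensorPow (ρ i) n) (E n)))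
        atTop (𝓝 (qcb ρ)) := by
  choose ev b hev hspec hpow using fun i => exists_spectral (hρ i).1
  choose B hB using fun (n : ℕ) (i : Fin r) => exists_tensor_basis n (b i)
  have hevn : ∀ (n : ℕ) (i : Fin r) (x : Fin n → Fin d), 0 ≤ ∏ k, ev i (x k) :=
    fun n i x => Finset.prod_nonneg fun _ _ => hev _ _
  choose sel e hrun using fun n : ℕ => exists_isRun (by omega)
    (ρ := fun i => tensorPow (ρ i) n) (ev := fun i x => ∏ k, ev i (x k)) (v := B n) (hevn n)
    fun i => by
      simp_rw [hB]
      exact tensorPow_eq_sum n (hspec i)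
  refine ⟨fun n i => ∑ s with (sel n s).1 = i, ketBra (e n s), fun n => (hrun n).isDetector,
    fun n => ⟨_, _, _, _, hrun n, fun i => rfl⟩, ?_⟩
  set F : Fin r → Fin r → ℝ → ℝ := fun i k s =>
    ∑ j, ∑ l, ev i j ^ (1 - s) * ev k l ^ s * ‖inner ℂ (b k l) (b i j)‖ ^ 2 with hF
  have hF0 : ∀ i k s, 0 ≤ F i k s := fun i k s => Finset.sum_nonneg fun j _ =>
    Finset.sum_nonneg fun l _ => mul_nonneg (mul_nonneg (Real.rpow_nonneg (hev _ _) _)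
      (Real.rpow_nonneg (hev _ _) _)) (sq_nonneg _)
  have hbdd : ∀ i k, BddBelow (Set.range fun s : Set.Icc (0 : ℝ) 1 => F i k s) := fun i k =>
    ⟨0, by rintro _ ⟨s, rfl⟩; exact hF0 _ _ _⟩
  have hpair : ∀ i k, qcbPair (ρ i) (ρ k) = -elog (⨅ s : Set.Icc (0 : ℝ) 1, F i k s) := by
    intro i k
    unfold qcbPair
    simp_rw [hpow, trace_sum_ketBra_mul]
    rfl
  have : Nonempty {p : Fin r × Fin r // p.1 < p.2} :=
    ⟨⟨(⟨0, by omega⟩, ⟨1, by omega⟩), by simp [Fin.lt_def]⟩⟩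
  -- The hardest pair: the largest Chernoff quantity is the smallest exponent.
  obtain ⟨p, hp⟩ := Finite.exists_max fun p : {p : Fin r × Fin r // p.1 < p.2} =>
    ⨅ s : Set.Icc (0 : ℝ) 1, F p.1.1 p.1.2 s
  set q := ⨅ s : Set.Icc (0 : ℝ) 1, F p.1.1 p.1.2 s with hq
  have hq0 : 0 ≤ q := Real.iInf_nonneg fun s => hF0 _ _ _
  have hqcb : qcb ρ = -elog q := by
    unfold qcb
    simp_rw [hpair]
    exact le_antisymm (iInf_le _ p) (le_iInf fun p' => EReal.neg_le_neg_iff.mpr (elog_mono (hp p')))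
  have hS : ∀ n i k, ∑ x, ∑ y, min (∏ m, ev i (x m)) (∏ m, ev k (y m)) *
      ‖inner ℂ (B n k y) (B n i x)‖ ^ 2 = minOverlap n (ev i) (ev k) (b i) (b k) := by
    intro n i k
    simp_rw [hB]
    rfl
  rw [hqcb]
  have herr0 : ∀ n, 0 ≤ err (fun i => tensorPow (ρ i) n)
      (fun i => ∑ s with (sel n s).1 = i, ketBra (e n s)) := fun n => (hrun n).err_nonneg (hevn n)
  refine tendsto_neg_one_div_mul_elog herr0 (tendsto_rpow_one_div herr0 hq0 ?_ ?_)
  · intro q' hqq'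
    obtain ⟨c, hc0, hc1, hc⟩ := exists_uniform_overlap_le hspec hLI
    have hmin : ∀ n i k, k ≠ i → minOverlap n (ev i) (ev k) (b i) (b k) ≤ q' ^ n := by
      have hlt : ∀ n i k, i < k → minOverlap n (ev i) (ev k) (b i) (b k) ≤ q' ^ n := by
        intro n i k hik
        obtain ⟨s, hs⟩ := exists_lt_of_ciInf_lt ((hp ⟨(i, k), hik⟩).trans_lt hqq')
        exact (minOverlap_le (hev i) (hev k) s.2).trans
          (pow_le_pow_left₀ (hF0 i k s) hs.le n)
      intro n i k hki
      rcases lt_or_gt_of_ne hki with hlt' | hlt'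
      · rw [minOverlap_comm]
        exact hlt n k i hlt'
      · exact hlt n i k hlt'
    have hlim : Tendsto (fun n : ℕ => 1 - c ^ n * r) atTop (𝓝 1) := by
      have := ((tendsto_pow_atTop_nhds_zero_of_lt_one hc0 hc1).mul_const (r : ℝ)).const_sub 1
      simpa using this
    have hrpos : (0 : ℝ) < r := by exact_mod_cast (by omega : 0 < r)
    -- At most r² overlaps, the prefactor 1/r, and K⁻¹ = 2 from the Gram bound 1/2.
    refine ⟨2 * r, by positivity, ?_⟩
    filter_upwards [hlim.eventually_const_lt (show (2⁻¹ : ℝ) < 1 by norm_num)] with n hn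
    have hq'0 : 0 ≤ q' ^ n := pow_nonneg (hq0.trans hqq'.le) n
    refine ((hrun n).err_le (K := 2⁻¹) (by norm_num) (hevn n) fun γ hγ => ?_).trans ?_
    · simp_rw [hB]
      refine le_trans ?_ (gram_tensor_le hc0 hc γ hγ)
      exact mul_le_mul_of_nonneg_right hn.le (Finset.sum_nonneg fun _ _ => sq_nonneg _)
    · simp_rw [hS]
      have hsum : ∑ i, ∑ k with k ≠ i, minOverlap n (ev i) (ev k) (b i) (b k) ≤
          r * (r * q' ^ n) := by
        calc _ ≤ ∑ i : Fin r, ∑ k : Fin r, q' ^ n := by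
              refine Finset.sum_le_sum fun i _ => ?_
              refine (Finset.sum_le_sum fun k hk =>
                hmin n i k (Finset.mem_filter.mp hk).2).trans ?_
              exact Finset.sum_le_sum_of_subset_of_nonneg (Finset.subset_univ _) fun _ _ _ => hq'0
          _ = _ := by simp
      calc _ ≤ (1 / (r : ℝ)) * (2⁻¹⁻¹ * (r * (r * q' ^ n))) := by gcongr
        _ = 2 * r * q' ^ n := by field_simp
  · intro q' hq'0 hq'
    -- The factor 1/r · 1/2 comes from `IsRun.le_err`, the other 1/2 from the law of large numbers.
    refine ⟨1 / (r : ℝ) * (2⁻¹ * (1 / 2)), by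
      have : (0 : ℝ) < r := by exact_mod_cast (by omega : 0 < r)
      positivity, ?_⟩
    have hqpos := hq'0.trans hq'
    -- The tolerance ε = log(q / q') is chosen so that q e^(-ε) = q'.
    have hε : 0 < Real.log (q / q') := Real.log_pos ((one_lt_div hq'0).mpr hq')
    have hexp : q * Real.exp (-Real.log (q / q')) = q' := by
      rw [Real.exp_neg, Real.exp_log (by positivity)]
      field_simp
    have hev1 := eventually_le_minOverlap (b := b p.1.1) (b' := b p.1.2) (hev p.1.1) (hev p.1.2)
      hqpos (fun s hs => ciInf_le (hbdd p.1.1 p.1.2) ⟨s, hs.1.le, hs.2.le⟩) hε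
    rw [hexp] at hev1
    filter_upwards [hev1] with n hn
    refine le_trans ?_ ((hrun n).le_err (hevn n) p.2.ne')
    rw [hS, mul_assoc, mul_assoc]
    gcongr

end MultipleQCB

theorem theorem2 (d r : ℕ) (hr : 2 ≤ r) (ρ : Fin r → Matrix (Fin d) (Fin d) ℂ)
    (hρ : ∀ i, MultipleQCB.IsDensityMatrix (ρ i)) (hLI : MultipleQCB.ConditionLI ρ) :
    ∃ E : (n : ℕ) → Fin r → Matrix (Fin n → Fin d) (Fin n → Fin d) ℂ,
      (∀ n, MultipleQCB.IsDetector (E n)) ∧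
      (∀ n, MultipleQCB.IsAlgorithmDetector (fun i => MultipleQCB.tensorPow (ρ i) n) (E n)) ∧
      Tendsto
        (fun n : ℕ => ((-(1 / (n : ℝ)) : ℝ) : EReal) *
          MultipleQCB.elog (MultipleQCB.err (fun i => MultipleQCB.tensorPow (ρ i) n) (E n)))
        atTop (𝓝 (MultipleQCB.qcb ρ)) :=
  MultipleQCB.exists_algorithmDetector_tendsto_qcb d r hr ρ hρ hLI
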